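/- Let $n\ge 2$ and $m\ge 1$ be integers, let $\alpha_M>0$, $r_0>0$ and $V,\tilde\kappa\in\mathbb R$, and let $(S,G)$ be a compact smooth Riemannian manifold of dimension $m$ with Laplace–Beltrami operator $\Delta$. Put $I=(0,r_0)$ and $$a_0=\frac{2n(n-1)}{\alpha_M},\qquad \bar V=\frac{\alpha_M}{n(n-1)}V .$$ For $\bar\Lambda\in\mathbb R$ let $H=H_{\bar\Lambda}$ be the operator, acting on functions $\psi(r,y)$ of $(r,y)\in I\times S$, $$H\psi=r^{-1}\tfrac{\partial}{\partial r}\Big(r\tfrac{\partial\psi}{\partial r}\Big)+r^{-2}\Big(-\tfrac{4}{n^2}a_0\Delta\psi-\tfrac{(m-1)^2}{4}\psi\Big)+\tfrac{16}{n^2}(\bar V+\bar\Lambda)r^2\psi-\tfrac{16}{n^2}\tilde\kappa\, r^{\frac{2(n-2)}{n}}\psi .$$ Let $\mu$ be an eigenvalue of $-\Delta$ such that $$\bar\mu=\tfrac{4}{n^2}a_0\mu-\tfrac{(m-1)^2}{4}\le 0 .$$ Let $L^2(I,1)$ be the Hilbert space of complex functions on $I$ with scalar product $\int_I r\,u\bar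 v\,dr$, let $\mathcal H_1(\bar\mu)$ be the completion of $C_c^\infty(I,\mathbb C)$ with respect to $$\langle u,v\rangle_1=\int_I r\,u'\,\overline{v'}\,dr-\bar\mu\int_I r^{-1}u\bar v\,dr ,$$ whose elements are regarded as functions on $I$ through the continuous extension $\mathcal H_1(\bar\mu)\to L^2(I,1)$ of the inclusion of $C_c^\infty(I,\mathbb C)$, and let $Bu=-r^{-1}(ru')'-r^{-2}\bar\mu u$. A solution of the eigenvalue problem $$Bu-\tfrac{16}{n^2}\bar V r^2u+\tfrac{16}{n^2}\tilde\kappa\, r^{\frac{2(n-2)}{n}}u=\tfrac{16}{n^2}\bar\Lambda\, r^2u \qquad(\ast)$$ in $\mathcal H_1(\bar\mu)$ is a function $u\in\mathcal H_1(\bar\mu)$ with $$\langle u,v\rangle_1+\int_I r\Big(-\tfrac{16}{n^2}\bar V r^2+\tfrac{16}{n^2}\tilde\kappa\, r^{\frac{2(n-2)}{n}}\Big)u\bar v\,dr=\bar\Lambda\int_I\tfrac{16}{n^2}r^3u\bar v\,dr\qquad\forall\,v\in\mathcal H_1(\bar\mu),$$ and $\bar\Lambda\in\mathbb R$ is an eigenvalue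 if there is a solution $u\neq 0$. Then the eigenvalues of $(\ast)$ are exactly the members of a sequence $(\bar\Lambda_i)_{i\in\mathbb N}$ with $$\bar\Lambda_i<\bar\Lambda_{i+1}\quad\forall\,i\in\mathbb N,\qquad \lim_{i\to\infty}\bar\Lambda_i=\infty ,$$ and each has multiplicity one: there are eigenfunctions $u_i\in\mathcal H_1(\bar\mu)$, $u_i\ne0$, real-valued and smooth in $I$, such that the solutions of $(\ast)$ for $\bar\Lambda=\bar\Lambda_i$ are exactly the multiples $cu_i$, $c\in\mathbb C$; moreover $u_i$ satisfies $(\ast)$ pointwise in $I$. The $(u_i)$ form an unconditional Schauder basis of $\mathcal H_1(\bar\mu)$. They also form a basis of $L^2(I,1)$ in the sense of a Markushevich basis: their linear span is dense in $L^2(I,1)$, and there are continuous linear functionals $f_i$ on $L^2(I,1)$ with $f_i(u_j)=\delta_{ij}$ such that $w=0$ is the only $w\in L^2(I,1)$ with $f_i(w)=0$ for all $i$. Finally, for every (smooth) $\eta:S\to\mathbb C$ with $-\Delta\eta=\mu\eta$, the wave functions $$\psi_i(r,y)=u_i(r)\,\eta(y)$$ are solutions of $H_{\bar\Lambda_i}\psi_i=0$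 in $I\times S$. -/

import Mathlib

open MeasureTheory Set Filter Topology
open scoped Manifold ContDiff ComplexConjugate

noncomputable section

namespace FriedmanModel

/-! ### Weighted Lebesgue spaces on `I = (0, r₀)` -/

/-- The measure `r ^ q dr` on the interval `(0, r₀)`. -/
def weightMeasure (r₀ q : ℝ) : Measure ℝ :=
  (volume.restrict (Ioo 0 r₀)).withDensity (fun r => ENNReal.ofReal (r ^ q))

/-- The Hilbert space `L²(I, q)` of complex functions `u` on `I = (0, r₀)` with
`∫_I r ^ q |u| ^ 2 < ∞`. -/
abbrev WeightedL2 (r₀ q : ℝ) : Type := Lp ℂ 2 (weightMeasure r₀ q)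

/-! ### The space `C_c^∞(I)` with the scalar product `⟨·, ·⟩₁`, and its completion -/

/-- `C_c^∞((0, r₀), ℂ)`, each function being extended by zero to the real line. -/
def testFunctions (r₀ : ℝ) : Submodule ℂ (ℝ → ℂ) where
  carrier := {φ | ContDiff ℝ ∞ φ ∧ HasCompactSupport φ ∧ tsupport φ ⊆ Ioo 0 r₀}
  zero_mem' := by
    refine ⟨contDiff_const, HasCompactSupport.zero, ?_⟩
    simp [tsupport]
  add_mem' := by
    rintro φ ψ ⟨h1, h2, h3⟩ ⟨k1, k2, k3⟩
    exact ⟨h1.add k1, h2.add k2, (tsupport_add φ ψ).trans (union_subset h3 k3)⟩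
  smul_mem' := by
    rintro c φ ⟨h1, h2, h3⟩
    refine ⟨contDiff_const.smul h1, h2.smul_left (f := fun _ => c), ?_⟩
    exact (tsupport_smul_subset_right (fun _ => c) φ).trans h3

/-- The test functions, as a space that will carry the scalar product with parameter `b ≤ 0`
(`b` is the shifted eigenvalue of the matter Laplacian). -/
def TestSpace (r₀ b : ℝ) (_hb : b ≤ 0) : Type := testFunctions r₀

section TestSpace

variable {r₀ b : ℝ} {hb : b ≤ 0}

instance : AddCommGroup (TestSpace r₀ b hb) :=
  inferInstanceAs (AddCommGroup (testFunctions r₀))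

instance : Module ℂ (TestSpace r₀ b hb) :=
  inferInstanceAs (Module ℂ (testFunctions r₀))

/-- The function on the real line underlying a test function. -/
def TestSpace.fn (φ : TestSpace r₀ b hb) : ℝ → ℂ := Subtype.val (p := (· ∈ testFunctions r₀)) φ

theorem TestSpace.contDiff (φ : TestSpace r₀ b hb) : ContDiff ℝ ∞ φ.fn := φ.2.1

theorem TestSpace.hasCompactSupport (φ : TestSpace r₀ b hb) : HasCompactSupport φ.fn := φ.2.2.1

theorem TestSpace.tsupport_subset (φ : TestSpace r₀ b hb) : tsupport φ.fn ⊆ Ioo 0 r₀ := φ.2.2.2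

theorem TestSpace.fn_add (φ ψ : TestSpace r₀ b hb) : (φ + ψ).fn = φ.fn + ψ.fn := rfl

theorem TestSpace.fn_smul (c : ℂ) (φ : TestSpace r₀ b hb) : (c • φ).fn = c • φ.fn := rfl

theorem TestSpace.differentiable (φ : TestSpace r₀ b hb) : Differentiable ℝ φ.fn :=
  φ.contDiff.differentiable (by simp)

theorem TestSpace.continuous_deriv (φ : TestSpace r₀ b hb) : Continuous (deriv φ.fn) :=
  φ.contDiff.continuous_deriv (by simp)

/-- The scalar product
`⟨u, v⟩₁ = ∫_I r u' conj(v') - b ∫_I r⁻¹ u conj(v)` on test functions. -/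
def form1 (u v : TestSpace r₀ b hb) : ℂ :=
  (∫ r in Ioo 0 r₀, (r : ℂ) * (deriv u.fn r * conj (deriv v.fn r)))
    - b * ∫ r in Ioo 0 r₀, (r : ℂ)⁻¹ * (u.fn r * conj (v.fn r))

theorem integrable_deriv (u v : TestSpace r₀ b hb) :
    Integrable (fun r : ℝ => (r : ℂ) * (deriv u.fn r * conj (deriv v.fn r))) := by
  apply Continuous.integrable_of_hasCompactSupport
  · have := u.continuous_deriv
    have := v.continuous_deriv
    fun_prop
  · exact (u.hasCompactSupport.deriv.mul_right).mul_left

theorem integrable_inv (u v : TestSpace r₀ b hb) :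
    Integrable (fun r : ℝ => (r : ℂ)⁻¹ * (u.fn r * conj (v.fn r))) := by
  have hc : HasCompactSupport (fun r : ℝ => u.fn r * conj (v.fn r)) :=
    u.hasCompactSupport.mul_right
  have h1 := u.contDiff.continuous
  have h2 := v.contDiff.continuous
  apply Continuous.integrable_of_hasCompactSupport
  · apply continuous_of_tsupport
    intro x hx
    have hx' : x ∈ tsupport u.fn := by
      refine closure_mono ?_ hx
      intro y hy hy'
      exact hy (by simp [hy'])
    have hx0 : (x : ℂ) ≠ 0 := by
      exact_mod_cast (u.tsupport_subset hx').1.ne'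
    exact ((Complex.continuous_ofReal.continuousAt).inv₀ hx0).mul (by fun_prop)
  · exact hc.mul_left

theorem form1_self (u : TestSpace r₀ b hb) :
    form1 u u = (((∫ r in Ioo 0 r₀, r * ‖deriv u.fn r‖ ^ 2)
      - b * ∫ r in Ioo 0 r₀, r⁻¹ * ‖u.fn r‖ ^ 2 : ℝ) : ℂ) := by
  unfold form1
  push_cast
  rw [← integral_complex_ofReal, ← integral_complex_ofReal]
  congr 2
  · ext r
    rw [Complex.mul_conj, Complex.normSq_eq_norm_sq]; push_cast; ring
  · congr 1; ext r
    rw [Complex.mul_conj, Complex.normSq_eq_norm_sq]; push_cast; ring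

/-- The positive semidefinite scalar product `⟨·, ·⟩₁` on the test functions, in the convention in
which `inner` is linear in its second argument. It is in fact definite. -/
instance testCore : PreInnerProductSpace.Core ℂ (TestSpace r₀ b hb) where
  inner u v := form1 v u
  conj_inner_symm u v := by
    simp only [form1, map_sub, map_mul, ← integral_conj, Complex.conj_ofReal, map_inv₀,
      Complex.conj_conj]
    congr 1
    · congr 1; ext r; ring
    · congr 2; ext r; ring
  re_inner_nonneg u := by
    rw [form1_self]
    have h1 : 0 ≤ ∫ r in Ioo 0 r₀, r * ‖deriv u.fn r‖ ^ 2 :=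
      setIntegral_nonneg measurableSet_Ioo fun r hr =>
        mul_nonneg hr.1.le (sq_nonneg _)
    have h2 : 0 ≤ ∫ r in Ioo 0 r₀, r⁻¹ * ‖u.fn r‖ ^ 2 :=
      setIntegral_nonneg measurableSet_Ioo fun r hr =>
        mul_nonneg (inv_nonneg.2 hr.1.le) (sq_nonneg _)
    simp only [RCLike.re_to_complex, Complex.ofReal_re]
    nlinarith
  add_left u v w := by
    have e1 : ∀ r, deriv (u + v).fn r = deriv u.fn r + deriv v.fn r := fun r => by
      rw [TestSpace.fn_add]; exact deriv_add (u.differentiable r) (v.differentiable r)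
    have e2 : ∀ r, (u + v).fn r = u.fn r + v.fn r := fun r => rfl
    simp only [form1, e1, e2, map_add, mul_add]
    rw [integral_add (integrable_deriv w u).integrableOn (integrable_deriv w v).integrableOn,
      integral_add (integrable_inv w u).integrableOn (integrable_inv w v).integrableOn]
    ring
  smul_left u v c := by
    have e1 : ∀ r, deriv (c • u).fn r = c * deriv u.fn r := fun r => by
      rw [TestSpace.fn_smul, deriv_const_smul_field]; rfl
    have e2 : ∀ r, (c • u).fn r = c * u.fn r := fun r => rfl
    simp only [form1, e1, e2, map_mul]
    have a1 : ∀ r : ℝ, (r : ℂ) * (deriv v.fn r * (conj c * conj (deriv u.fn r)))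
        = conj c * ((r : ℂ) * (deriv v.fn r * conj (deriv u.fn r))) := fun r => by ring
    have a2 : ∀ r : ℝ, (r : ℂ)⁻¹ * (v.fn r * (conj c * conj (u.fn r)))
        = conj c * ((r : ℂ)⁻¹ * (v.fn r * conj (u.fn r))) := fun r => by ring
    simp only [a1, a2, integral_const_mul]
    ring

instance : SeminormedAddCommGroup (TestSpace r₀ b hb) :=
  InnerProductSpace.Core.toSeminormedAddCommGroup (𝕜 := ℂ)

instance : InnerProductSpace ℂ (TestSpace r₀ b hb) := InnerProductSpace.ofCore testCore

theorem norm_sq_eq (u : TestSpace r₀ b hb) :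
    ‖u‖ ^ 2 = (∫ r in Ioo 0 r₀, r * ‖deriv u.fn r‖ ^ 2)
      - b * ∫ r in Ioo 0 r₀, r⁻¹ * ‖u.fn r‖ ^ 2 := by
  have h : inner ℂ u u = form1 u u := rfl
  rw [← inner_self_eq_norm_sq (𝕜 := ℂ), h, form1_self]
  simp

/-- The weighted Sobolev space `H₁(b)`: the completion of `C_c^∞(I)` with respect to the scalar
product `⟨·, ·⟩₁`. -/
abbrev H1 (r₀ b : ℝ) (hb : b ≤ 0) : Type := UniformSpace.Completion (TestSpace r₀ b hb)

/-! ### The canonical map `H₁(b) → L²(I, 1)` -/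

instance : IsFiniteMeasure (weightMeasure r₀ 1) := by
  refine isFiniteMeasure_withDensity_ofReal ?_
  have : Integrable (fun r : ℝ => r) (volume.restrict (Ioo 0 r₀)) :=
    (continuous_id.integrableOn_Icc (a := 0) (b := r₀)).mono_set Ioo_subset_Icc_self
  simpa using this.2

theorem TestSpace.memLp (φ : TestSpace r₀ b hb) : MemLp φ.fn 2 (weightMeasure r₀ 1) :=
  φ.contDiff.continuous.memLp_of_hasCompactSupport φ.hasCompactSupport

/-- The inclusion of the test functions into `L²(I, 1)`. -/
def testToL2 (r₀ b : ℝ) (hb : b ≤ 0) : TestSpace r₀ b hb →ₗ[ℂ] WeightedL2 r₀ 1 where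
  toFun φ := φ.memLp.toLp φ.fn
  map_add' _ _ := rfl
  map_smul' _ _ := rfl

theorem norm_testToL2_sq (φ : TestSpace r₀ b hb) :
    ‖testToL2 r₀ b hb φ‖ ^ 2 = ∫ r in Ioo 0 r₀, r * ‖φ.fn r‖ ^ 2 := by
  have h1 : inner ℂ (testToL2 r₀ b hb φ) (testToL2 r₀ b hb φ)
      = ∫ r, inner ℂ (φ.fn r) (φ.fn r) ∂(weightMeasure r₀ 1) := by
    rw [L2.inner_def]
    refine integral_congr_ae ?_
    filter_upwards [φ.memLp.coeFn_toLp] with r hr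
    change inner ℂ ((φ.memLp.toLp φ.fn) r) ((φ.memLp.toLp φ.fn) r) = _
    rw [hr]
  rw [← inner_self_eq_norm_sq (𝕜 := ℂ), h1, weightMeasure,
    integral_withDensity_eq_integral_toReal_smul (by fun_prop) (by simp)]
  have h2 : ∫ r in Ioo 0 r₀, (ENNReal.ofReal (r ^ (1 : ℝ))).toReal • inner ℂ (φ.fn r) (φ.fn r)
      = ((∫ r in Ioo 0 r₀, r * ‖φ.fn r‖ ^ 2 : ℝ) : ℂ) := by
    rw [← integral_complex_ofReal]
    refine setIntegral_congr_fun measurableSet_Ioo fun r hr => ?_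
    simp only [Real.rpow_one, ENNReal.toReal_ofReal hr.1.le, inner_self_eq_norm_sq_to_K]
    simp
  rw [h2]
  simp

/-- A Poincare inequality. -/
theorem poincare (φ : TestSpace r₀ b hb) :
    ∫ r in Ioo 0 r₀, r * ‖φ.fn r‖ ^ 2 ≤ r₀ ^ 2 * ∫ r in Ioo 0 r₀, r * ‖deriv φ.fn r‖ ^ 2 := by
  have c0 : Continuous φ.fn := φ.contDiff.continuous
  have c1 := φ.continuous_deriv
  have s0 := φ.hasCompactSupport
  have s1 : HasCompactSupport (deriv φ.fn) := s0.deriv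
  have n0 : HasCompactSupport (fun r => ‖φ.fn r‖ ^ 2) := s0.comp_left (g := fun z => ‖z‖ ^ 2) (by simp)
  have n1 : HasCompactSupport (fun r => ‖deriv φ.fn r‖ ^ 2) :=
    s1.comp_left (g := fun z => ‖z‖ ^ 2) (by simp)
  have n2 : HasCompactSupport (fun r => inner ℝ (φ.fn r) (deriv φ.fn r)) := by
    refine s0.mono' fun r hr => subset_tsupport _ ?_
    intro h
    exact hr (by simp [h])
  have iA : Integrable (fun r : ℝ => r * ‖φ.fn r‖ ^ 2) :=
    Continuous.integrable_of_hasCompactSupport (by fun_prop) n0.mul_left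
  have iB : Integrable (fun r : ℝ => r ^ 2 * inner ℝ (φ.fn r) (deriv φ.fn r)) :=
    Continuous.integrable_of_hasCompactSupport (by fun_prop) n2.mul_left
  have iC : Integrable (fun r : ℝ => r ^ 3 * ‖deriv φ.fn r‖ ^ 2) :=
    Continuous.integrable_of_hasCompactSupport (by fun_prop) n1.mul_left
  have iD : Integrable (fun r : ℝ => r * ‖deriv φ.fn r‖ ^ 2) :=
    Continuous.integrable_of_hasCompactSupport (by fun_prop) n1.mul_left
  have iF : Integrable (fun r : ℝ => r ^ 2 * ‖φ.fn r‖ ^ 2) :=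
    Continuous.integrable_of_hasCompactSupport (by fun_prop) n0.mul_left
  have z : ∀ r, r ∉ Ioo 0 r₀ → φ.fn r = 0 := fun r hr =>
    image_eq_zero_of_notMem_tsupport fun h => hr (φ.tsupport_subset h)
  have hF : ∀ r, HasDerivAt (fun r : ℝ => r ^ 2 * ‖φ.fn r‖ ^ 2)
      (2 * (r * ‖φ.fn r‖ ^ 2) + 2 * (r ^ 2 * inner ℝ (φ.fn r) (deriv φ.fn r))) r := fun r => by
    have := (hasDerivAt_pow 2 r).mul ((φ.differentiable r).hasDerivAt.norm_sq)
    refine this.congr_deriv ?_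
    simp
    ring
  have h0 := integral_eq_zero_of_hasDerivAt_of_integrable hF
    ((iA.const_mul 2).add (iB.const_mul 2)) iF
  rw [integral_add (iA.const_mul 2) (iB.const_mul 2), integral_const_mul, integral_const_mul] at h0
  have eA : ∫ r in Ioo 0 r₀, r * ‖φ.fn r‖ ^ 2 = ∫ r, r * ‖φ.fn r‖ ^ 2 :=
    setIntegral_eq_integral_of_forall_compl_eq_zero fun r hr => by simp [z r hr]
  have eB : ∫ r in Ioo 0 r₀, r ^ 2 * inner ℝ (φ.fn r) (deriv φ.fn r)
      = ∫ r, r ^ 2 * inner ℝ (φ.fn r) (deriv φ.fn r) :=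
    setIntegral_eq_integral_of_forall_compl_eq_zero fun r hr => by simp [z r hr]
  have hS : 0 ≤ ∫ r in Ioo 0 r₀, r * ‖φ.fn r + r • deriv φ.fn r‖ ^ 2 :=
    setIntegral_nonneg measurableSet_Ioo fun r hr => mul_nonneg hr.1.le (sq_nonneg _)
  have eS : ∀ r : ℝ, r * ‖φ.fn r + r • deriv φ.fn r‖ ^ 2 = (r * ‖φ.fn r‖ ^ 2
      + 2 * (r ^ 2 * inner ℝ (φ.fn r) (deriv φ.fn r))) + r ^ 3 * ‖deriv φ.fn r‖ ^ 2 := fun r => by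
    rw [norm_add_sq_real, norm_smul, inner_smul_right, mul_pow, Real.norm_eq_abs, sq_abs]
    ring
  simp only [eS] at hS
  have iAB : Integrable (fun r : ℝ => r * ‖φ.fn r‖ ^ 2
      + 2 * (r ^ 2 * inner ℝ (φ.fn r) (deriv φ.fn r))) := iA.add (iB.const_mul 2)
  rw [integral_add iAB.integrableOn iC.integrableOn,
    integral_add iA.integrableOn (iB.const_mul 2).integrableOn, integral_const_mul, eA, eB] at hS
  have hC : ∫ r in Ioo 0 r₀, r ^ 3 * ‖deriv φ.fn r‖ ^ 2
      ≤ ∫ r in Ioo 0 r₀, r₀ ^ 2 * (r * ‖deriv φ.fn r‖ ^ 2) := by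
    refine setIntegral_mono_on iC.integrableOn (iD.const_mul _).integrableOn measurableSet_Ioo
      fun r hr => ?_
    have : r ^ 3 * ‖deriv φ.fn r‖ ^ 2 = r ^ 2 * (r * ‖deriv φ.fn r‖ ^ 2) := by ring
    rw [this]
    refine mul_le_mul_of_nonneg_right ?_ (mul_nonneg hr.1.le (sq_nonneg _))
    exact pow_le_pow_left₀ hr.1.le hr.2.le 2
  rw [integral_const_mul] at hC
  rw [eA]
  linarith

theorem norm_testToL2_le (φ : TestSpace r₀ b hb) : ‖testToL2 r₀ b hb φ‖ ≤ |r₀| * ‖φ‖ := by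
  refine abs_le_of_sq_le_sq' ?_ (by positivity) |>.2
  have h2 : 0 ≤ ∫ r in Ioo 0 r₀, r⁻¹ * ‖φ.fn r‖ ^ 2 :=
    setIntegral_nonneg measurableSet_Ioo fun r hr =>
      mul_nonneg (inv_nonneg.2 hr.1.le) (sq_nonneg _)
  rw [norm_testToL2_sq, mul_pow, sq_abs, norm_sq_eq]
  refine (poincare φ).trans (mul_le_mul_of_nonneg_left ?_ (sq_nonneg _))
  nlinarith

/-- The inclusion of the test functions into `L²(I, 1)` as a bounded operator. -/
def testToL2L (r₀ b : ℝ) (hb : b ≤ 0) : TestSpace r₀ b hb →L[ℂ] WeightedL2 r₀ 1 :=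
  (testToL2 r₀ b hb).mkContinuous |r₀| norm_testToL2_le

/-- The canonical map `H₁(b) → L²(I, 1)`, the continuous extension of the inclusion of the test
functions. An element of the completion is regarded as a function on `I` through this map. -/
def H1.toL2 (r₀ b : ℝ) (hb : b ≤ 0) : H1 r₀ b hb →L[ℂ] WeightedL2 r₀ 1 :=
  (testToL2L r₀ b hb).extend (UniformSpace.Completion.toComplL (𝕜 := ℂ))

theorem H1.toL2_coe (φ : TestSpace r₀ b hb) :
    H1.toL2 r₀ b hb (φ : H1 r₀ b hb) = testToL2 r₀ b hb φ :=
  ContinuousLinearMap.extend_eq _ (UniformSpace.Completion.denseRange_coe)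
    (UniformSpace.Completion.isUniformInducing_coe _) φ

end TestSpace

/-! ### The Laplace-Beltrami operator of a Riemannian manifold -/

section Laplace

variable {m : ℕ} {S : Type*} [TopologicalSpace S] [ChartedSpace (EuclideanSpace ℝ (Fin m)) S]
  [IsManifold (𝓡 m) ∞ S]

/-- A smooth Riemannian metric on the tangent bundle of an `m`-dimensional manifold. -/
abbrev Metric (m : ℕ) (S : Type*) [TopologicalSpace S]
    [ChartedSpace (EuclideanSpace ℝ (Fin m)) S] [IsManifold (𝓡 m) ∞ S] : Type _ :=
  Bundle.ContMDiffRiemannianMetric (𝓡 m) ∞ (EuclideanSpace ℝ (Fin m))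
    (fun x : S => TangentSpace (𝓡 m) x)

/-- The coordinate vector field `∂_A` of the preferred chart at `x`, at the point with
coordinates `z`. -/
def coordVector (x : S) (A : Fin m) (z : EuclideanSpace ℝ (Fin m)) :
    TangentSpace (𝓡 m) ((extChartAt (𝓡 m) x).symm z) :=
  mfderiv 𝓘(ℝ, EuclideanSpace ℝ (Fin m)) (𝓡 m) (extChartAt (𝓡 m) x).symm z
    (EuclideanSpace.single A (1 : ℝ))

/-- The matrix `G_{AB}` of the metric in the preferred chart at `x`, at the point with
coordinates `z`. -/
def gram (G : Metric m S) (x : S) (z : EuclideanSpace ℝ (Fin m)) : Matrix (Fin m) (Fin m) ℝ :=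
  Matrix.of fun A B =>
    G.inner ((extChartAt (𝓡 m) x).symm z) (coordVector x A z) (coordVector x B z)

/-- The Laplace-Beltrami operator
`Δη = |G|^(-1/2) ∂_A (|G|^(1/2) G^{AB} ∂_B η)`, computed at `x` in the preferred chart at `x`. -/
def laplaceBeltrami (G : Metric m S) (η : S → ℂ) (x : S) : ℂ :=
  (√(gram G x (extChartAt (𝓡 m) x x)).det)⁻¹ •
    ∑ A : Fin m, fderiv ℝ
      (fun z => √(gram G x z).det • ∑ B : Fin m, ((gram G x z)⁻¹ A B) •
        fderiv ℝ (η ∘ (extChartAt (𝓡 m) x).symm) z (EuclideanSpace.single B (1 : ℝ)))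
      (extChartAt (𝓡 m) x x) (EuclideanSpace.single A (1 : ℝ))

/-- `η` belongs to the eigenspace `E_μ` of `-Δ` (eigenfunctions are smooth). -/
def MemEigenspace (G : Metric m S) (μ : ℝ) (η : S → ℂ) : Prop :=
  ContMDiff (𝓡 m) 𝓘(ℝ, ℂ) ∞ η ∧ ∀ x, -laplaceBeltrami G η x = μ * η x

/-- `μ` is an eigenvalue of `-Δ`. -/
def IsEigenvalue (G : Metric m S) (μ : ℝ) : Prop := ∃ η, MemEigenspace G μ η ∧ η ≠ 0

end Laplace

/-! ### The constants and the operators of the model -/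

/-- `a₀ = 2 n (n - 1) / α_M`. -/
def a0 (n : ℕ) (αM : ℝ) : ℝ := 2 * n * (n - 1) / αM

/-- The normalized potential `α_M V / (n (n - 1))`. -/
def VBar (n : ℕ) (αM V : ℝ) : ℝ := αM / (n * (n - 1)) * V

/-- The shifted eigenvalue `(4 / n²) a₀ μ - (m - 1)² / 4`. -/
def muBar (n m : ℕ) (αM μ : ℝ) : ℝ := 4 / n ^ 2 * a0 n αM * μ - ((m : ℝ) - 1) ^ 2 / 4

/-- The Bessel operator `Bu = -r⁻¹ (r u')' - r⁻² b u`. -/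
def besselOp (b : ℝ) (u : ℝ → ℝ) (r : ℝ) : ℝ :=
  -(r⁻¹ * deriv (fun s => s * deriv u s) r) - (r ^ 2)⁻¹ * b * u r

/-- The Hamilton operator
`Hψ = r⁻¹ ∂_r (r ∂_r ψ) + r⁻² (-(4/n²) a₀ Δψ - (m-1)²/4 ψ) + (16/n²) (V̄ + Λ̄) r² ψ
  - (16/n²) κ r^(2(n-2)/n) ψ`, acting on functions of `r > 0` and `y ∈ S`. -/
def hamiltonian {m : ℕ} {S : Type*} [TopologicalSpace S]
    [ChartedSpace (EuclideanSpace ℝ (Fin m)) S] [IsManifold (𝓡 m) ∞ S]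
    (n : ℕ) (αM V κ Λ : ℝ) (G : Metric m S) (ψ : ℝ → S → ℂ) (r : ℝ) (y : S) : ℂ :=
  ((r⁻¹ : ℝ) : ℂ) * deriv (fun s : ℝ => (s : ℂ) * deriv (fun t => ψ t y) s) r
    + (((r ^ 2)⁻¹ : ℝ) : ℂ) * (-((4 / n ^ 2 * a0 n αM : ℝ) : ℂ) * laplaceBeltrami G (ψ r) y
        - ((((m : ℝ) - 1) ^ 2 / 4 : ℝ) : ℂ) * ψ r y)
    + ((16 / n ^ 2 * (VBar n αM V + Λ) * r ^ 2 : ℝ) : ℂ) * ψ r y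
    - ((16 / n ^ 2 * κ * r ^ (2 * ((n : ℝ) - 2) / n) : ℝ) : ℂ) * ψ r y

/-- `U ∈ H₁(b)` solves the implicit eigenvalue problem
`Bu - (16/n²) V̄ r² u + (16/n²) κ r^(2(n-2)/n) u = (16/n²) Λ̄ r² u` with eigenvalue parameter `Λ̄`,
where `⟨Bu, v⟩ = ⟨u, v⟩₁` and the other scalar products are those of `L²(I, 1)`:
the equation is tested against all `v ∈ H₁(b)`. -/
def SolvesEigenvalueProblem {r₀ b : ℝ} {hb : b ≤ 0} (n : ℕ) (Vb κ Λ : ℝ)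
    (U : H1 r₀ b hb) : Prop :=
  ∀ v : H1 r₀ b hb,
    inner ℂ v U
      + ∫ r in Ioo 0 r₀, ((r * (-(16 / n ^ 2 * Vb * r ^ 2)
            + 16 / n ^ 2 * κ * r ^ (2 * ((n : ℝ) - 2) / n)) : ℝ) : ℂ)
          * (H1.toL2 r₀ b hb U r * conj (H1.toL2 r₀ b hb v r))
      = (Λ : ℂ) * ∫ r in Ioo 0 r₀, ((r * (16 / n ^ 2 * r ^ 2) : ℝ) : ℂ)
          * (H1.toL2 r₀ b hb U r * conj (H1.toL2 r₀ b hb v r))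

/-- A Markushevich basis: a sequence with dense linear span that has a biorthogonal sequence of
continuous functionals separating the points. -/
def IsMarkushevichBasis {E : Type*} [NormedAddCommGroup E] [NormedSpace ℂ E] (e : ℕ → E) : Prop :=
  (Submodule.span ℂ (range e)).topologicalClosure = ⊤ ∧
    ∃ f : ℕ → E →L[ℂ] ℂ, (∀ i j, f i (e j) = if i = j then 1 else 0) ∧
      ∀ x, (∀ i, f i x = 0) → x = 0

end FriedmanModel

end

/-! The weak problem is an equation `U + Q U = Λ K U` in the Hilbert space `H1`. The operators `Q`
and `K` represent the forms of the potential and of the weight `(16/n²) r²`. Both have the form `J*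
M J`, where `J` is `H1.toL2` and `M` is multiplication by a bounded function.

Three facts about `J` put the problem within reach of spectral theory. It is compact
(`H1.isCompactOperator_toL2`), hence so is `K`. It is injective (`H1.toL2_injective`), hence `K` is
positive definite. Finally the `L²(I, 1)` norm is at most a small multiple of the `H1` norm plus a
multiple of the `K`-form (`H1.norm_toL2_sq_le`), so `A = 1 + Q + c K` is coercive for a suitable
`c`. All three come from writing an element of `H1` as the primitive `prim` of its weak derivative,
vanishing at `r₀`; the term with `b ≤ 0` only enlarges the norm.

Let `B` be the square root of `A`. Under `y = B U` the equation becomes `B⁻¹ K B⁻¹ y = (Λ + c)⁻¹ y`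
with a compact, symmetric, injective operator. Its eigenvectors span a dense subspace and its
eigenvalues accumulate only at zero, so the `Λ` can accumulate only at infinity. Once eigenvalues
are simple, the normalized `B U i` form a Hilbert basis, and applying `B⁻¹` yields an unconditional
Schauder basis of `H1` (`exists_eigenvalues_basis`).

Simplicity is an ODE fact. By the lemma of du Bois-Reymond a weak solution is a classical solution
of the system `r u' = p`, `p' = -k u` on `(0, r₀]` (`exists_isRadialSol`). This system is regular at
`r₀`, where `u` vanishes, so `p r₀` determines `u`. No analysis at the singular end `0` is needed.
Normalizing `p r₀ = 1` also makes the solution real.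

In `L²(I, 1)` the eigenfunctions are orthogonal for the weight `r²`, which supplies the biorthogonal
functionals. The wave equation follows by separation of variables, with `muBar` absorbing the shift
`(m - 1)²/4`. -/

namespace FriedmanModel

/-! ### Enumeration of a discrete set of reals -/

/-- An infinite set of reals with finite initial sections is the range of a strictly increasing
sequence tending to infinity. -/
theorem exists_strictMono_range_eq {s : Set ℝ} (hs : s.Infinite)
    (hfin : ∀ R, (s ∩ Iic R).Finite) :
    ∃ f : ℕ → ℝ, StrictMono f ∧ Tendsto f atTop atTop ∧ range f = s := by
  classical
  obtain ⟨x₀, hx₀⟩ := hs.nonempty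
  obtain ⟨m, hm, hmin⟩ := (hfin x₀).exists_minimalFor id _ ⟨x₀, hx₀, le_refl x₀⟩
  have hbot : ∀ x ∈ s, m ≤ x := by
    intro x hx
    by_cases h : x ≤ x₀
    · rcases le_total m x with h' | h'
      · exact h'
      · exact hmin ⟨hx, h⟩ h'
    · exact hm.2.trans (not_le.1 h).le
  -- Finite intervals, a least element and no greatest one characterize the order type of `ℕ`.
  let _ : LocallyFiniteOrder s := LocallyFiniteOrder.ofFiniteIcc fun a b => by
    refine Set.Finite.of_finite_image (f := Subtype.val) ((hfin b).subset ?_)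
      Subtype.val_injective.injOn
    rintro _ ⟨y, hy, rfl⟩
    exact ⟨y.2, hy.2⟩
  let _ : OrderBot s := { bot := ⟨m, hm.1⟩, bot_le := fun x => hbot x x.2 }
  let _ : SuccOrder s := LinearLocallyFiniteOrder.succOrder s
  let _ : PredOrder s := LinearLocallyFiniteOrder.predOrder s
  have _ : NoMaxOrder s := ⟨fun a => by
    by_contra h
    push Not at h
    exact hs ((hfin a).subset fun x hx => ⟨hx, h ⟨x, hx⟩⟩)⟩
  let e : ℕ ≃o s := orderIsoNatOfLinearSuccPredArch.symm
  have hmono : StrictMono fun i => (e i : ℝ) := fun i j hij => e.strictMono hij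
  have hrange : range (fun i => (e i : ℝ)) = s := by
    ext x
    exact ⟨fun ⟨i, hi⟩ => hi ▸ (e i).2, fun hx => ⟨e.symm ⟨x, hx⟩, by simp⟩⟩
  refine ⟨_, hmono, ?_, hrange⟩
  refine hmono.monotone.tendsto_atTop_atTop fun R => ?_
  by_contra h
  push Not at h
  refine hs ((hfin R).subset fun x hx => ⟨hx, ?_⟩)
  rw [← hrange] at hx
  obtain ⟨i, rfl⟩ := hx
  exact (h i).le

/-! ### Abstract generalized eigenvalue problem -/

section Abstract

variable {H : Type*} [NormedAddCommGroup H] [InnerProductSpace ℂ H]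

/-- An orthonormal sequence of eigenvectors of a compact operator cannot have eigenvalues bounded
away from zero. -/
theorem not_forall_le_of_orthonormal_eigenvectors {T : H →L[ℂ] H} (hT : IsCompactOperator T)
    {x : ℕ → H} (hx : Orthonormal ℂ x) {l : ℕ → ℝ} (hl : ∀ i, T (x i) = (l i : ℂ) • x i)
    {ε : ℝ} (hε : 0 < ε) (h : ∀ i, ε ≤ l i) : False := by
  obtain ⟨K, hK, hsub⟩ := hT.image_closedBall_subset_compact (𝕜₁ := ℂ) 1
  have hmem : ∀ i, T (x i) ∈ K := fun i =>
    hsub ⟨x i, by simp [hx.1 i], rfl⟩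
  obtain ⟨a, -, φ, hφ, hlim⟩ := hK.tendsto_subseq hmem
  have hc := hlim.cauchySeq
  rw [Metric.cauchySeq_iff'] at hc
  obtain ⟨N, hN⟩ := hc ε hε
  have h1 := hN (N + 1) (Nat.le_succ N)
  have hne : φ (N + 1) ≠ φ N := (hφ (Nat.lt_succ_self N)).ne'
  simp only [Function.comp_apply, hl, dist_eq_norm] at h1
  -- By orthogonality the squared distance of two images is `l² + l'² ≥ 2 ε²`, against the distance
  -- below `ε` in a Cauchy subsequence.
  have horth : inner ℂ ((l (φ (N + 1)) : ℂ) • x (φ (N + 1))) ((l (φ N) : ℂ) • x (φ N)) = 0 := by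
    rw [inner_smul_left, inner_smul_right, hx.2 hne]; simp
  have h2 := norm_sub_sq (𝕜 := ℂ) ((l (φ (N + 1)) : ℂ) • x (φ (N + 1))) ((l (φ N) : ℂ) • x (φ N))
  rw [horth, norm_smul, norm_smul, hx.1, hx.1] at h2
  simp only [Complex.norm_real, Real.norm_eq_abs, map_zero, mul_zero, sub_zero, mul_one,
    sq_abs] at h2
  have h3 := h (φ (N + 1))
  have h4 := h (φ N)
  nlinarith [norm_nonneg ((l (φ (N + 1)) : ℂ) • x (φ (N + 1)) - (l (φ N) : ℂ) • x (φ N))]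

/-- `U` solves `U + Q U = Λ K U`. -/
def IsSol (Q K : H →L[ℂ] H) (Λ : ℝ) (U : H) : Prop := U + Q U = (Λ : ℂ) • K U

theorem IsSol.smul {Q K : H →L[ℂ] H} {Λ : ℝ} {U : H} (h : IsSol Q K Λ U) (a : ℂ) :
    IsSol Q K Λ (a • U) := by
  unfold IsSol at *
  rw [map_smul, map_smul, ← smul_add, h, smul_comm]

variable [CompleteSpace H]

/-- A self-adjoint coercive operator is the square of a symmetric invertible one. -/
theorem exists_equiv_sq_eq {A : H →L[ℂ] H} (hA : IsSelfAdjoint A)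
    {c : ℝ} (hc : 0 < c) (hco : ∀ x, c * ‖x‖ ^ 2 ≤ RCLike.re (inner ℂ x (A x))) :
    ∃ B : H ≃L[ℂ] H, (∀ x y, inner ℂ (B x) y = inner ℂ x (B y)) ∧ ∀ x, B (B x) = A x := by
  have hpos : 0 ≤ A := by
    rw [ContinuousLinearMap.nonneg_iff_isPositive, ContinuousLinearMap.isPositive_def]
    refine ⟨hA.isSymmetric, fun x => ?_⟩
    rw [ContinuousLinearMap.reApplyInnerSelf_apply, inner_re_symm]
    exact (by positivity : 0 ≤ c * ‖x‖ ^ 2).trans (hco x)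
  have hu : IsUnit A := by
    refine ContinuousLinearMap.isUnit_of_forall_le_norm_inner_map A (c := ⟨c, hc.le⟩) hc fun x => ?_
    rw [norm_inner_symm]
    refine le_trans ?_ (RCLike.re_le_norm _)
    have := hco x
    rw [mul_comm]
    exact this
  have hu' : IsUnit (CFC.sqrt A) := (CFC.isUnit_sqrt_iff A hpos).2 hu
  have hsa : IsSelfAdjoint (CFC.sqrt A) := (CFC.sqrt_nonneg A).isSelfAdjoint
  let B : H ≃L[ℂ] H := ContinuousLinearEquiv.unitsEquiv ℂ H hu'.unit
  have hB : ∀ x, B x = CFC.sqrt A x := fun x => rfl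
  refine ⟨B, fun x y => ?_, fun x => ?_⟩
  · rw [hB, hB]
    exact hsa.isSymmetric x y
  · rw [hB, hB, ← mul_apply_eq_comp, CFC.sqrt_mul_sqrt_self A hpos]

/-- The data of an abstract generalized eigenvalue problem `U + Q U = Λ K U` in a Hilbert space
with compact positive definite `K`, coercive after adding a multiple of `K`. -/
structure GeneralizedEigenproblem (Q K : H →L[ℂ] H) (c : ℝ) : Prop where
  selfAdjoint_left : IsSelfAdjoint Q
  selfAdjoint_right : IsSelfAdjoint K
  compact : IsCompactOperator K
  pos : ∀ x, x ≠ 0 → 0 < RCLike.re (inner ℂ x (K x))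
  coercive : ∀ x, 1 / 2 * ‖x‖ ^ 2 ≤ RCLike.re (inner ℂ x (x + Q x + (c : ℂ) • K x))

variable {Q K : H →L[ℂ] H} {c : ℝ}

namespace GeneralizedEigenproblem

/-- Evaluating `⟨U, (1 + Q) V⟩` on either side by symmetry gives `(Λ' - Λ) ⟨U, K V⟩ = 0`. -/
theorem inner_eq_zero (h : GeneralizedEigenproblem Q K c) {Λ Λ' : ℝ} {U V : H}
    (hU : IsSol Q K Λ U) (hV : IsSol Q K Λ' V) (hne : Λ ≠ Λ') : inner ℂ U (K V) = 0 := by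
  have h1 : inner ℂ U (V + Q V) = inner ℂ (U + Q U) V := by
    rw [inner_add_left, inner_add_right]
    congr 1
    exact (h.selfAdjoint_left.isSymmetric U V).symm
  rw [hU, hV, inner_smul_left, inner_smul_right, Complex.conj_ofReal,
    show inner ℂ (K U) V = inner ℂ U (K V) from h.selfAdjoint_right.isSymmetric U V] at h1
  have h2 : ((Λ' : ℂ) - Λ) * inner ℂ U (K V) = 0 := by linear_combination h1
  rcases mul_eq_zero.1 h2 with h3 | h3
  · exact absurd (by exact_mod_cast (sub_eq_zero.1 h3).symm) hne
  · exact h3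

theorem exists_equiv (h : GeneralizedEigenproblem Q K c) :
    ∃ B : H ≃L[ℂ] H, (∀ x y, inner ℂ (B x) y = inner ℂ x (B y)) ∧
    ∀ x, B (B x) = x + Q x + (c : ℂ) • K x := by
  have hA : IsSelfAdjoint (1 + Q + (c : ℂ) • K) := by
    refine ((IsSelfAdjoint.one _).add h.selfAdjoint_left).add ?_
    exact IsSelfAdjoint.smul (by simp [isSelfAdjoint_iff]) h.selfAdjoint_right
  obtain ⟨B, hB, hBB⟩ := exists_equiv_sq_eq hA (c := 1 / 2) (by norm_num)
    (fun x => by simpa using h.coercive x)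
  exact ⟨B, hB, fun x => by simpa using hBB x⟩

/-- Pairing the equation with `U` gives `(Λ + c) ⟨U, K U⟩ ≥ ‖U‖² / 2 > 0`. This bounds the spectrum
below and makes the reciprocal `(Λ + c)⁻¹` legitimate. -/
theorem add_pos_of_isSol (h : GeneralizedEigenproblem Q K c) {Λ : ℝ} {U : H}
    (hU : IsSol Q K Λ U) (h0 : U ≠ 0) : 0 < Λ + c := by
  have h1 := h.coercive U
  have h2 : U + Q U + (c : ℂ) • K U = ((Λ + c : ℝ) : ℂ) • K U := by
    rw [show U + Q U = _ from hU, ← add_smul]; push_cast; rfl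
  rw [h2, inner_smul_right, RCLike.re_to_complex, Complex.re_ofReal_mul] at h1
  have h3 := h.pos U h0
  have h4 : 0 < ‖U‖ := norm_pos_iff.2 h0
  rw [RCLike.re_to_complex] at h3
  by_contra hneg
  nlinarith [mul_nonneg (neg_nonneg.2 (not_lt.1 hneg)) h3.le, pow_pos h4 2]

variable {B : H ≃L[ℂ] H}

/-- The equation reads `B (B U) = (Λ + c) K U`; applying `B⁻¹` turns it into an ordinary eigenvalue
equation for the vector `B U`. -/
theorem symm_apply_of_isSol (h : GeneralizedEigenproblem Q K c)
    (hBB : ∀ x, B (B x) = x + Q x + (c : ℂ) • K x) {Λ : ℝ} {U : H}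
    (hU : IsSol Q K Λ U) (h0 : U ≠ 0) :
    B.symm (K (B.symm (B U))) = (((Λ + c)⁻¹ : ℝ) : ℂ) • B U := by
  have h1 := h.add_pos_of_isSol hU h0
  have h2 : B (B U) = ((Λ + c : ℝ) : ℂ) • K U := by
    rw [hBB, show U + Q U = _ from hU, ← add_smul]; push_cast; rfl
  have h3 : K U = (((Λ + c)⁻¹ : ℝ) : ℂ) • B (B U) := by
    rw [h2, smul_smul, ← Complex.ofReal_mul, inv_mul_cancel₀ h1.ne']; simp
  rw [B.symm_apply_apply, h3, map_smul, B.symm_apply_apply]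

theorem inner_equiv_eq_zero (h : GeneralizedEigenproblem Q K c)
    (hBB : ∀ x, B (B x) = x + Q x + (c : ℂ) • K x)
    (hB : ∀ x y, inner ℂ (B x) y = inner ℂ x (B y)) {Λ Λ' : ℝ} {U V : H}
    (hU : IsSol Q K Λ U) (hV : IsSol Q K Λ' V)
    (hne : Λ ≠ Λ') : inner ℂ (B U) (B V) = 0 := by
  rw [hB, hBB, show V + Q V = _ from hV, ← add_smul, inner_smul_right,
    h.inner_eq_zero hU hV hne, mul_zero]

theorem orthonormal_normalize (h : GeneralizedEigenproblem Q K c)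
    (hBB : ∀ x, B (B x) = x + Q x + (c : ℂ) • K x)
    (hB : ∀ x y, inner ℂ (B x) y = inner ℂ x (B y)) {ι : Type*} {Λ : ι → ℝ}
    (hΛ : Function.Injective Λ) {U : ι → H}
    (hU : ∀ i, IsSol Q K (Λ i) (U i)) (h0 : ∀ i, U i ≠ 0) :
    Orthonormal ℂ fun i => ((‖B (U i)‖⁻¹ : ℝ) : ℂ) • B (U i) := by
  refine ⟨fun i => ?_, fun i j hij => ?_⟩
  · have : ‖B (U i)‖ ≠ 0 := by simpa using h0 i
    rw [norm_smul, Complex.norm_real, norm_inv, norm_norm, inv_mul_cancel₀ this]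
  · change inner ℂ _ _ = _
    rw [inner_smul_left, inner_smul_right,
      h.inner_equiv_eq_zero hBB hB (hU i) (hU j) (hΛ.ne hij)]
    simp

theorem isCompactOperator_conj (h : GeneralizedEigenproblem Q K c) :
    IsCompactOperator ((B.symm : H →L[ℂ] H) ∘L K ∘L (B.symm : H →L[ℂ] H)) :=
  (h.compact.comp_clm (B.symm : H →L[ℂ] H)).clm_comp (B.symm : H →L[ℂ] H)

/-- Completeness: the spectral theorem for the compact symmetric `B⁻¹ K B⁻¹` says that its
eigenspaces have trivial orthogonal complement, and each eigenvector is `B U` for a solution `U`. -/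
theorem eq_zero_of_forall_inner_eq_zero (h : GeneralizedEigenproblem Q K c)
    (hBB : ∀ x, B (B x) = x + Q x + (c : ℂ) • K x)
    (hB : ∀ x y, inner ℂ (B x) y = inner ℂ x (B y)) {x : H}
    (hx : ∀ Λ U, IsSol Q K Λ U → inner ℂ (B U) x = 0) : x = 0 := by
  set S : H →L[ℂ] H := (B.symm : H →L[ℂ] H) ∘L K ∘L (B.symm : H →L[ℂ] H) with hS
  have hSapp : ∀ y, S y = B.symm (K (B.symm y)) := fun y => rfl
  have hBs : ∀ x y, inner ℂ (B.symm x) y = inner ℂ x (B.symm y) := fun x y => by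
    conv_rhs => rw [← B.apply_symm_apply x, hB, B.apply_symm_apply]
  have hsymm : S.IsSymmetric := fun x y => by
    change inner ℂ (S x) y = inner ℂ x (S y)
    rw [hSapp, hSapp, hBs, show inner ℂ (K _) _ = inner ℂ _ (K _) from
      h.selfAdjoint_right.isSymmetric _ _, hBs]
  have hbot := ContinuousLinearMap.orthogonalComplement_iSup_eigenspaces_eq_bot
    h.isCompactOperator_conj hsymm
  rw [← Submodule.mem_bot ℂ, ← hbot, Submodule.mem_orthogonal]
  intro y hy
  refine Submodule.iSup_induction (motive := fun y => inner ℂ y x = 0) _ hy ?_ (by simp) ?_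
  · intro μ y hy
    by_cases hy0 : y = 0
    · simp [hy0]
    have hy' : S y = μ • y := Module.End.mem_eigenspace_iff.1 hy
    have hev : Module.End.HasEigenvalue (S : Module.End ℂ H) μ :=
      Module.End.hasEigenvalue_of_hasEigenvector ⟨hy, hy0⟩
    have hre : (μ.re : ℂ) = μ := Complex.conj_eq_iff_re.1 (hsymm.conj_eigenvalue_eq_self hev)
    have hK : K (B.symm y) = μ • B y := by
      rw [← map_smul, ← hy', hSapp, B.apply_symm_apply]
    -- A zero eigenvalue would put a nonzero vector in the kernel of the positive definite `K`.
    have hμ : μ.re ≠ 0 := by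
      intro h0
      have : B.symm y ≠ 0 := by simpa using hy0
      have h1 := h.pos _ this
      rw [hK, ← hre, h0] at h1
      simp at h1
    -- Inverts `μ = (Λ + c)⁻¹`.
    have hsol : IsSol Q K (μ.re⁻¹ - c) (B.symm y) := by
      have h1 := hBB (B.symm y)
      rw [B.apply_symm_apply] at h1
      have h2 : B y = ((μ.re⁻¹ : ℝ) : ℂ) • K (B.symm y) := by
        rw [hK, smul_smul]
        nth_rewrite 2 [← hre]
        rw [← Complex.ofReal_mul, inv_mul_cancel₀ hμ]; simp
      unfold IsSol
      rw [eq_sub_of_add_eq h1.symm, h2, ← sub_smul]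
      push_cast; rfl
    have := hx _ _ hsol
    rwa [B.apply_symm_apply] at this
  · intro y z hy hz
    rw [inner_add_left, hy, hz, add_zero]

/-- Infinitely many `Λ ≤ R` would give an orthonormal sequence of eigenvectors of `B⁻¹ K B⁻¹` with
eigenvalues at least `(R + c)⁻¹`, contradicting compactness. -/
theorem finite_eigenvalues (h : GeneralizedEigenproblem Q K c) (R : ℝ) :
    ({Λ | ∃ U, U ≠ 0 ∧ IsSol Q K Λ U} ∩ Iic R).Finite := by
  by_contra hinf
  obtain ⟨B, hB, hBB⟩ := h.exists_equiv
  let f := Set.Infinite.natEmbedding _ hinf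
  choose U h0 hU using fun i => (f i).2.1
  have horth := h.orthonormal_normalize hBB hB (Λ := fun i => (f i : ℝ))
    (Subtype.val_injective.comp f.injective) hU h0
  have hpos := fun i => h.add_pos_of_isSol (hU i) (h0 i)
  have hR : 0 < R + c := (hpos 0).trans_le (by
    have := (f 0).2.2
    simp only [mem_Iic] at this
    linarith)
  refine not_forall_le_of_orthonormal_eigenvectors
    (h.isCompactOperator_conj (B := B)) horth (l := fun i => ((f i : ℝ) + c)⁻¹)
    (fun i => ?_) (inv_pos.2 hR) fun i => ?_
  · rw [map_smul, smul_comm]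
    congr 1
    exact h.symm_apply_of_isSol hBB (hU i) (h0 i)
  · have := (f i).2.2
    exact inv_anti₀ (hpos i) (by simp only [mem_Iic] at this; linarith)

/-- With simple eigenvalues, one vector per eigenvalue already spans all solutions; finitely many of
them would, by completeness, exhaust `H`. -/
theorem infinite_eigenvalues (h : GeneralizedEigenproblem Q K c)
    (hsimple : ∀ Λ U V, IsSol Q K Λ U → IsSol Q K Λ V → U ≠ 0 → ∃ a : ℂ, V = a • U)
    (hdim : ¬ FiniteDimensional ℂ H) :
    {Λ | ∃ U, U ≠ 0 ∧ IsSol Q K Λ U}.Infinite := by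
  intro hfin
  obtain ⟨B, hB, hBB⟩ := h.exists_equiv
  have := hfin.to_subtype
  choose U h0 hU using fun Λ : {Λ | ∃ U, U ≠ 0 ∧ IsSol Q K Λ U} => Λ.2
  set V := Submodule.span ℂ (range fun Λ => B (U Λ)) with hV
  have : FiniteDimensional ℂ V := FiniteDimensional.span_of_finite ℂ (finite_range _)
  have hbot : Vᗮ = ⊥ := by
    rw [Submodule.eq_bot_iff]
    intro x hx
    refine h.eq_zero_of_forall_inner_eq_zero hBB hB fun Λ W hW => ?_
    by_cases hW0 : W = 0
    · simp [hW0]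
    obtain ⟨a, ha⟩ := hsimple _ _ _ (hU ⟨Λ, W, hW0, hW⟩) hW (h0 _)
    rw [ha, map_smul]
    exact (Submodule.mem_orthogonal _ _).1 hx _
      (Submodule.smul_mem _ _ (Submodule.subset_span ⟨_, rfl⟩))
  have htop : V = ⊤ := by
    rw [← Submodule.orthogonal_orthogonal V, hbot, Submodule.bot_orthogonal_eq_top]
  refine hdim ?_
  rw [htop] at this
  exact Module.Finite.equiv (Submodule.topEquiv : (⊤ : Submodule ℂ H) ≃ₗ[ℂ] H)

/-- A generalized eigenvalue problem with simple eigenvalues: the eigenvalues form a strictly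
increasing sequence tending to infinity, and the eigenvectors an unconditional Schauder basis. -/
theorem exists_eigenvalues_basis (h : GeneralizedEigenproblem Q K c)
    (hsimple : ∀ Λ U V, IsSol Q K Λ U → IsSol Q K Λ V → U ≠ 0 → ∃ a : ℂ, V = a • U)
    (hdim : ¬ FiniteDimensional ℂ H) :
    ∃ Λ : ℕ → ℝ, StrictMono Λ ∧ Tendsto Λ atTop atTop ∧
      range Λ = {Λ | ∃ U, U ≠ 0 ∧ IsSol Q K Λ U} ∧
      ∀ U : ℕ → H, (∀ i, U i ≠ 0) → (∀ i, IsSol Q K (Λ i) (U i)) →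
        ∃ e : UnconditionalSchauderBasis ℕ ℂ H, ∀ i, e i = U i := by
  obtain ⟨Λ, hmono, hlim, hrange⟩ :=
    exists_strictMono_range_eq (h.infinite_eigenvalues hsimple hdim) h.finite_eigenvalues
  refine ⟨Λ, hmono, hlim, hrange, fun U h0 hU => ?_⟩
  obtain ⟨B, hB, hBB⟩ := h.exists_equiv
  have horth := h.orthonormal_normalize hBB hB hmono.injective hU h0
  have hn : ∀ i, ‖B (U i)‖ ≠ 0 := fun i => by simpa using h0 i
  -- Since every eigenvalue is some `Λ i` and is simple, orthogonality to the chosen vectors is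
  -- orthogonality to every `B W`.
  have hbot : (Submodule.span ℂ (range fun i => ((‖B (U i)‖⁻¹ : ℝ) : ℂ) • B (U i)))ᗮ = ⊥ := by
    rw [Submodule.eq_bot_iff]
    intro x hx
    refine h.eq_zero_of_forall_inner_eq_zero hBB hB fun Λ' W hW => ?_
    by_cases hW0 : W = 0
    · simp [hW0]
    obtain ⟨i, rfl⟩ : Λ' ∈ range Λ := hrange ▸ ⟨W, hW0, hW⟩
    obtain ⟨a, rfl⟩ := hsimple _ _ _ (hU i) hW (h0 i)
    have h1 := (Submodule.mem_orthogonal _ _).1 hx _ (Submodule.subset_span ⟨i, rfl⟩)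
    simp only [inner_smul_left, Complex.conj_ofReal, mul_eq_zero, Complex.ofReal_eq_zero,
      inv_eq_zero, hn, false_or] at h1
    rw [map_smul, inner_smul_left, h1, mul_zero]
  let b := HilbertBasis.mkOfOrthogonalEqBot horth hbot
  have hb : ∀ i, b i = ((‖B (U i)‖⁻¹ : ℝ) : ℂ) • B (U i) := fun i =>
    congrFun (HilbertBasis.coe_mkOfOrthogonalEqBot horth hbot) i
  have hbU : ∀ i, B (U i) = ((‖B (U i)‖ : ℝ) : ℂ) • b i := fun i => by
    rw [hb, smul_smul, ← Complex.ofReal_mul, mul_inv_cancel₀ (hn i)]; simp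
  -- `U i` is `‖B (U i)‖` times the preimage of a unit basis vector, so its coordinate is the
  -- Fourier coefficient of `B x` divided by that norm.
  let C : ℕ → H →L[ℂ] ℂ := fun i =>
    ((‖B (U i)‖⁻¹ : ℝ) : ℂ) • (innerSL ℂ (b i)) ∘L (B : H →L[ℂ] H)
  have hC : ∀ i x, C i x = ((‖B (U i)‖⁻¹ : ℝ) : ℂ) * inner ℂ (b i) (B x) := fun i x => rfl
  refine ⟨{ basis := U
            coord := C
            ortho := fun i j => ?_
            expansion := fun x => ?_ }, fun i => rfl⟩
  · let _ : DecidableEq ℕ := fun a b => Classical.propDecidable (a = b)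
    have h1 := b.orthonormal
    rw [hC, hbU j, inner_smul_right]
    by_cases hij : i = j
    · subst hij
      rw [Pi.single_eq_same, inner_self_eq_norm_sq_to_K, h1.1 i, ← mul_assoc,
        ← Complex.ofReal_mul, inv_mul_cancel₀ (hn i)]
      simp
    · rw [Pi.single_eq_of_ne hij, h1.2 hij, mul_zero, mul_zero]
  · have h1 := (b.hasSum_repr (B x)).mapL (B.symm : H →L[ℂ] H)
    simp only [ContinuousLinearEquiv.coe_coe, B.symm_apply_apply] at h1
    have h2 : ∀ i, B.symm (b i) = ((‖B (U i)‖⁻¹ : ℝ) : ℂ) • U i := fun i => by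
      rw [hb, map_smul, B.symm_apply_apply]
    have h3 : ∀ i, B.symm (b.repr (B x) i • b i) = C i x • U i := fun i => by
      rw [map_smul, h2, hC, b.repr_apply_apply, smul_smul, mul_comm]
    simpa only [h3] using h1

end GeneralizedEigenproblem

end Abstract

/-! ### The weighted space `L²(I, 1)` and primitives of its elements -/

section WeightedSpace

variable {r₀ : ℝ}

/-- The density `r` is positive on the interval, so the two measures have the same null sets. -/
theorem ae_weightMeasure_one_iff {P : ℝ → Prop} :
    (∀ᵐ r ∂weightMeasure r₀ 1, P r) ↔ ∀ᵐ r ∂volume.restrict (Ioo 0 r₀), P r := by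
  rw [weightMeasure, ae_withDensity_iff (by fun_prop)]
  refine eventually_congr ?_
  filter_upwards [ae_restrict_mem measurableSet_Ioo] with r hr
  simp [hr.1]

theorem integral_weightMeasure_one {E : Type*} [NormedAddCommGroup E] [NormedSpace ℝ E]
    (f : ℝ → E) : ∫ r, f r ∂weightMeasure r₀ 1 = ∫ r in Ioo 0 r₀, r • f r := by
  rw [weightMeasure, integral_withDensity_eq_integral_toReal_smul (by fun_prop) (by simp)]
  refine setIntegral_congr_fun measurableSet_Ioo fun r hr => ?_
  simp [ENNReal.toReal_ofReal hr.1.le]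

theorem integrable_weightMeasure_one_iff {E : Type*} [NormedAddCommGroup E] [NormedSpace ℝ E]
    (f : ℝ → E) :
    Integrable f (weightMeasure r₀ 1) ↔ IntegrableOn (fun r => r • f r) (Ioo 0 r₀) := by
  rw [weightMeasure, integrable_withDensity_iff_integrable_smul' (by fun_prop) (by simp)]
  refine integrable_congr ?_
  filter_upwards [ae_restrict_mem measurableSet_Ioo] with r hr
  simp [ENNReal.toReal_ofReal hr.1.le]

theorem WeightedL2.inner_eq (f g : WeightedL2 r₀ 1) :
    inner ℂ f g = ∫ r in Ioo 0 r₀, (r : ℂ) * (g r * conj (f r)) := by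
  rw [L2.inner_def, integral_weightMeasure_one]
  simp [RCLike.inner_apply]

theorem WeightedL2.norm_sq_eq (f : WeightedL2 r₀ 1) :
    ‖f‖ ^ 2 = ∫ r in Ioo 0 r₀, r * ‖f r‖ ^ 2 := by
  rw [← inner_self_eq_norm_sq (𝕜 := ℂ), inner_eq]
  have : ∀ r : ℝ, (r : ℂ) * (f r * conj (f r)) = ((r * ‖f r‖ ^ 2 : ℝ) : ℂ) := fun r => by
    rw [Complex.mul_conj, Complex.normSq_eq_norm_sq]; push_cast; ring
  simp only [this, integral_complex_ofReal]
  simp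

theorem WeightedL2.integrableOn_norm_sq (f : WeightedL2 r₀ 1) :
    IntegrableOn (fun r => r * ‖f r‖ ^ 2) (Ioo 0 r₀) :=
  (integrable_weightMeasure_one_iff _).1 (Lp.memLp f).integrable_norm_pow'

/-- The kernel `1_{(r, s)} / t` representing integration over `(r, s)`. -/
noncomputable def kernelFn (r s : ℝ) : ℝ → ℂ := (Ioo r s).indicator fun t => ((t⁻¹ : ℝ) : ℂ)

theorem measurable_kernelFn (r s : ℝ) : Measurable (kernelFn r s) := by
  unfold kernelFn
  exact Measurable.indicator (by fun_prop) measurableSet_Ioo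

theorem memLp_kernelFn {r : ℝ} (hr : 0 < r) (s : ℝ) :
    MemLp (kernelFn r s) 2 (weightMeasure r₀ 1) := by
  refine MemLp.of_bound (measurable_kernelFn r s).aestronglyMeasurable r⁻¹ (ae_of_all _ fun t => ?_)
  unfold kernelFn
  by_cases ht : t ∈ Ioo r s
  · rw [indicator_of_mem ht, Complex.norm_real, Real.norm_eq_abs, abs_inv,
      abs_of_pos (hr.trans ht.1)]
    exact inv_anti₀ hr ht.1.le
  · rw [indicator_of_notMem ht, norm_zero]
    exact (inv_pos.2 hr).le

/-- `kernelFn` as an element of `L²(I, 1)`. -/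
noncomputable def kernel {r : ℝ} (hr : 0 < r) (s : ℝ) : WeightedL2 r₀ 1 :=
  (memLp_kernelFn hr s).toLp

theorem kernel_ae {r : ℝ} (hr : 0 < r) (s : ℝ) :
    ∀ᵐ t ∂volume.restrict (Ioo 0 r₀), (kernel hr s : WeightedL2 r₀ 1) t = kernelFn r s t :=
  ae_weightMeasure_one_iff.1 (memLp_kernelFn hr s).coeFn_toLp

/-- The weight `t` of the scalar product cancels the factor `1 / t` of the kernel. Integration over
an interval away from `0` thus becomes a continuous functional on `L²(I, 1)`. -/
theorem inner_kernel {r s : ℝ} (hr : 0 < r) (hs : s ≤ r₀) (g : WeightedL2 r₀ 1) :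
    inner ℂ (kernel hr s) g = ∫ t in Ioo r s, g t := by
  rw [WeightedL2.inner_eq]
  have hsub : Ioo r s ⊆ Ioo 0 r₀ := Ioo_subset_Ioo hr.le hs
  have h0 : ∫ t in Ioo r s, g t = ∫ t in Ioo 0 r₀, (Ioo r s).indicator g t := by
    rw [setIntegral_indicator measurableSet_Ioo, inter_eq_right.2 hsub]
  rw [h0]
  refine integral_congr_ae ?_
  filter_upwards [kernel_ae hr s, ae_restrict_mem measurableSet_Ioo] with t ht htI
  rw [ht, kernelFn]
  by_cases h : t ∈ Ioo r s
  · rw [indicator_of_mem h, indicator_of_mem h, Complex.conj_ofReal]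
    have : (t : ℂ) ≠ 0 := by exact_mod_cast htI.1.ne'
    push_cast
    field_simp
  · rw [indicator_of_notMem h, indicator_of_notMem h]; simp

/-- Pairing the kernel with itself leaves the integral of `1 / t` over `(r, s)`. -/
theorem norm_kernel_sq {r s : ℝ} (hr : 0 < r) (hrs : r ≤ s) (hs : s ≤ r₀) :
    ‖(kernel hr s : WeightedL2 r₀ 1)‖ ^ 2 = Real.log (s / r) := by
  rw [← inner_self_eq_norm_sq (𝕜 := ℂ), inner_kernel hr hs]
  have h1 : ∫ t in Ioo r s, (kernel hr s : WeightedL2 r₀ 1) t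
      = ∫ t in Ioo r s, ((t⁻¹ : ℝ) : ℂ) := by
    refine integral_congr_ae ?_
    have := ae_restrict_of_ae_restrict_of_subset (Ioo_subset_Ioo hr.le hs)
      (kernel_ae (r₀ := r₀) hr s)
    filter_upwards [this, ae_restrict_mem measurableSet_Ioo] with t ht htI
    rw [ht, kernelFn, indicator_of_mem htI]
  rw [h1, integral_complex_ofReal, ← integral_Ioc_eq_integral_Ioo,
    ← intervalIntegral.integral_of_le hrs, integral_inv_of_pos hr (hr.trans_le hrs)]
  simp

/-- The weighted measure is finite, so `L²` functions are integrable for it; on `(r, r₀)` the weight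
is at least `r` and can be divided out. -/
theorem WeightedL2.integrableOn_Ioo {r : ℝ} (hr : 0 < r) (g : WeightedL2 r₀ 1) :
    IntegrableOn g (Ioo r r₀) := by
  have h1 : Integrable g (weightMeasure r₀ 1) := (Lp.memLp g).integrable (by norm_num)
  rw [integrable_weightMeasure_one_iff] at h1
  have h2 := h1.mono_set (Ioo_subset_Ioo_left hr.le)
  have h3 : IntegrableOn (fun t : ℝ => t⁻¹ • (t • g t)) (Ioo r r₀) := by
    refine Integrable.bdd_smul (φ := fun t : ℝ => t⁻¹) h2 r⁻¹
      (by fun_prop : Measurable fun t : ℝ => t⁻¹).aestronglyMeasurable ?_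
    filter_upwards [ae_restrict_mem measurableSet_Ioo] with t ht
    rw [norm_inv, Real.norm_of_nonneg (hr.le.trans ht.1.le)]
    exact inv_anti₀ hr ht.1.le
  refine h3.congr_fun (fun t ht => ?_) measurableSet_Ioo
  simp only
  rw [smul_smul, inv_mul_cancel₀ (hr.trans ht.1).ne', one_smul]

theorem WeightedL2.intervalIntegrable {r s : ℝ} (hr : 0 < r) (hrs : r ≤ s) (hs : s ≤ r₀)
    (g : WeightedL2 r₀ 1) : IntervalIntegrable g volume r s := by
  rw [intervalIntegrable_iff_integrableOn_Ioo_of_le hrs]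
  exact (g.integrableOn_Ioo hr).mono_set (Ioo_subset_Ioo_right hs)

theorem WeightedL2.norm_integral_sq_le {r s : ℝ} (hr : 0 < r) (hrs : r ≤ s) (hs : s ≤ r₀)
    (g : WeightedL2 r₀ 1) : ‖∫ t in r..s, g t‖ ^ 2 ≤ Real.log (s / r) * ‖g‖ ^ 2 := by
  rw [intervalIntegral.integral_of_le hrs, integral_Ioc_eq_integral_Ioo, ← inner_kernel hr hs,
    ← norm_kernel_sq hr hrs hs, ← mul_pow]
  exact pow_le_pow_left₀ (norm_nonneg _) (norm_inner_le_norm _ _) 2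

/-- The primitive of `g ∈ L²(I, 1)` that vanishes at `r₀`. -/
noncomputable def prim (g : WeightedL2 r₀ 1) (r : ℝ) : ℂ := -∫ t in r..r₀, g t

theorem prim_sub {r s : ℝ} (hr : 0 < r) (hrs : r ≤ s) (hs : s ≤ r₀) (g : WeightedL2 r₀ 1) :
    prim g s - prim g r = ∫ t in r..s, g t := by
  rw [prim, prim, ← intervalIntegral.integral_add_adjacent_intervals
    (g.intervalIntegrable hr hrs hs) (g.intervalIntegrable (hr.trans_le hrs) hs le_rfl)]
  ring

theorem prim_eq_inner {r : ℝ} (hr : 0 < r) (hr' : r ≤ r₀) (g : WeightedL2 r₀ 1) :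
    prim g r = -inner ℂ (kernel hr r₀) g := by
  rw [prim, inner_kernel hr le_rfl, intervalIntegral.integral_of_le hr',
    integral_Ioc_eq_integral_Ioo]

theorem prim_right (g : WeightedL2 r₀ 1) : prim g r₀ = 0 := by simp [prim]

/-- Cauchy-Schwarz gives the factor `log (s / r)`, and `log x ≤ x - 1` gives `r log (s / r) ≤ s -
r`. The weight `r` thus absorbs the logarithmic singularity at `0`, making the bound uniform;
compactness and the interpolation inequality both rest on it. -/
theorem norm_prim_sub_sq_le {r s : ℝ} (hr : 0 < r) (hrs : r ≤ s) (hs : s ≤ r₀)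
    (g : WeightedL2 r₀ 1) : r * ‖prim g s - prim g r‖ ^ 2 ≤ (s - r) * ‖g‖ ^ 2 := by
  have h1 := g.norm_integral_sq_le hr hrs hs
  rw [← prim_sub hr hrs hs] at h1
  have h2 : r * Real.log (s / r) ≤ s - r := by
    have h3 := Real.log_le_sub_one_of_pos (div_pos (hr.trans_le hrs) hr)
    calc r * Real.log (s / r) ≤ r * (s / r - 1) := mul_le_mul_of_nonneg_left h3 hr.le
      _ = s - r := by field_simp
  calc r * ‖prim g s - prim g r‖ ^ 2 ≤ r * (Real.log (s / r) * ‖g‖ ^ 2) :=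
        mul_le_mul_of_nonneg_left h1 hr.le
    _ = r * Real.log (s / r) * ‖g‖ ^ 2 := by ring
    _ ≤ _ := mul_le_mul_of_nonneg_right h2 (sq_nonneg _)

theorem continuousOn_prim (g : WeightedL2 r₀ 1) : ContinuousOn (prim g) (Ioc 0 r₀) := by
  intro x hx
  have hx2 : 0 < x / 2 := half_pos hx.1
  have h1 : ContinuousOn (fun r => ∫ t in r..r₀, g t) (uIcc (x / 2) r₀) := by
    have := intervalIntegral.continuousOn_primitive_interval_left
      (μ := volume) (f := g) (a := x / 2) (b := r₀) ?_
    · exact this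
    · rw [uIcc_of_le (by linarith [hx.2])]
      rw [integrableOn_Icc_iff_integrableOn_Ioo]
      exact g.integrableOn_Ioo hx2
  rw [uIcc_of_le (by linarith [hx.2])] at h1
  have h2 := (h1 x ⟨by linarith [hx.1], hx.2⟩).neg
  refine h2.mono_of_mem_nhdsWithin ?_
  filter_upwards [self_mem_nhdsWithin,
    mem_nhdsWithin_of_mem_nhds (lt_mem_nhds (show x / 2 < x by linarith [hx.1]))] with t ht ht'
  exact ⟨ht'.le, ht.2⟩

end WeightedSpace

/-! ### Weak derivatives; `H1` as a space of functions -/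

section Sobolev

variable {r₀ b : ℝ} {hb : b ≤ 0}

theorem TestSpace.memLp_deriv (φ : TestSpace r₀ b hb) :
    MemLp (deriv φ.fn) 2 (weightMeasure r₀ 1) :=
  φ.continuous_deriv.memLp_of_hasCompactSupport φ.hasCompactSupport.deriv

theorem TestSpace.deriv_add (φ ψ : TestSpace r₀ b hb) :
    deriv (φ + ψ).fn = deriv φ.fn + deriv ψ.fn := by
  ext r
  rw [TestSpace.fn_add]
  exact _root_.deriv_add (φ.differentiable r) (ψ.differentiable r)

theorem TestSpace.deriv_smul (c : ℂ) (φ : TestSpace r₀ b hb) :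
    deriv (c • φ).fn = c • deriv φ.fn := by
  ext r
  rw [TestSpace.fn_smul, deriv_const_smul_field]
  rfl

theorem TestSpace.eq_zero_of_notMem (φ : TestSpace r₀ b hb) {r : ℝ} (hr : r ∉ Ioo 0 r₀) :
    φ.fn r = 0 :=
  image_eq_zero_of_notMem_tsupport fun h => hr (φ.tsupport_subset h)

/-- The derivative of test functions, as a map into `L²(I, 1)`. -/
noncomputable def testDeriv (r₀ b : ℝ) (hb : b ≤ 0) :
    TestSpace r₀ b hb →ₗ[ℂ] WeightedL2 r₀ 1 where
  toFun φ := φ.memLp_deriv.toLp (deriv φ.fn)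
  map_add' φ ψ := by
    rw [← MemLp.toLp_add]
    exact MemLp.toLp_congr _ _ (by rw [φ.deriv_add])
  map_smul' c φ := by
    rw [← MemLp.toLp_const_smul]
    exact MemLp.toLp_congr _ _ (by rw [φ.deriv_smul]; rfl)

theorem testDeriv_ae (φ : TestSpace r₀ b hb) :
    ∀ᵐ r ∂volume.restrict (Ioo 0 r₀), testDeriv r₀ b hb φ r = deriv φ.fn r :=
  ae_weightMeasure_one_iff.1 φ.memLp_deriv.coeFn_toLp

theorem testToL2_ae (φ : TestSpace r₀ b hb) :
    ∀ᵐ r ∂volume.restrict (Ioo 0 r₀), testToL2 r₀ b hb φ r = φ.fn r :=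
  ae_weightMeasure_one_iff.1 φ.memLp.coeFn_toLp

theorem norm_testDeriv_le (φ : TestSpace r₀ b hb) : ‖testDeriv r₀ b hb φ‖ ≤ 1 * ‖φ‖ := by
  rw [one_mul]
  refine abs_le_of_sq_le_sq' ?_ (norm_nonneg _) |>.2
  have h2 : 0 ≤ ∫ r in Ioo 0 r₀, r⁻¹ * ‖φ.fn r‖ ^ 2 :=
    setIntegral_nonneg measurableSet_Ioo fun r hr =>
      mul_nonneg (inv_nonneg.2 hr.1.le) (sq_nonneg _)
  have h3 : ∫ r in Ioo 0 r₀, r * ‖testDeriv r₀ b hb φ r‖ ^ 2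
      = ∫ r in Ioo 0 r₀, r * ‖deriv φ.fn r‖ ^ 2 := by
    refine integral_congr_ae ?_
    filter_upwards [testDeriv_ae φ] with r hr
    rw [hr]
  rw [WeightedL2.norm_sq_eq, h3, norm_sq_eq]
  nlinarith

/-- The derivative of test functions as a bounded operator. -/
noncomputable def testDerivL (r₀ b : ℝ) (hb : b ≤ 0) :
    TestSpace r₀ b hb →L[ℂ] WeightedL2 r₀ 1 :=
  (testDeriv r₀ b hb).mkContinuous 1 norm_testDeriv_le

/-- The weak derivative `H₁(b) → L²(I, 1)`. -/
noncomputable def H1.deriv (r₀ b : ℝ) (hb : b ≤ 0) : H1 r₀ b hb →L[ℂ] WeightedL2 r₀ 1 :=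
  (testDerivL r₀ b hb).extend (UniformSpace.Completion.toComplL (𝕜 := ℂ))

theorem H1.deriv_coe (φ : TestSpace r₀ b hb) :
    H1.deriv r₀ b hb (φ : H1 r₀ b hb) = testDeriv r₀ b hb φ :=
  ContinuousLinearMap.extend_eq _ (UniformSpace.Completion.denseRange_coe)
    (UniformSpace.Completion.isUniformInducing_coe _) φ

theorem H1.norm_deriv_le (U : H1 r₀ b hb) : ‖H1.deriv r₀ b hb U‖ ≤ ‖U‖ := by
  induction U using UniformSpace.Completion.induction_on with
  | hp => exact isClosed_le (by fun_prop) (by fun_prop)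
  | ih φ =>
    rw [H1.deriv_coe, UniformSpace.Completion.norm_coe]
    simpa using norm_testDeriv_le φ

theorem prim_testDeriv (φ : TestSpace r₀ b hb) {r : ℝ} (hr : r ∈ Ioc 0 r₀) :
    prim (testDeriv r₀ b hb φ) r = φ.fn r := by
  have h1 : ∫ t in r..r₀, testDeriv r₀ b hb φ t = ∫ t in r..r₀, deriv φ.fn t := by
    rw [intervalIntegral.integral_of_le hr.2, intervalIntegral.integral_of_le hr.2,
      integral_Ioc_eq_integral_Ioo, integral_Ioc_eq_integral_Ioo]
    exact integral_congr_ae (ae_restrict_of_ae_restrict_of_subset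
      (Ioo_subset_Ioo_left hr.1.le) (testDeriv_ae φ))
  rw [prim, h1, intervalIntegral.integral_deriv_eq_sub (fun x _ => φ.differentiable x)
    (φ.continuous_deriv.intervalIntegrable _ _), φ.eq_zero_of_notMem (r := r₀) (by simp)]
  simp

/-- Elements of `H₁(b)` are represented by the primitives of their weak derivatives. -/
theorem H1.toL2_ae (U : H1 r₀ b hb) : ∀ᵐ r ∂volume.restrict (Ioo 0 r₀),
    H1.toL2 r₀ b hb U r = prim (H1.deriv r₀ b hb U) r := by
  obtain ⟨φ, hφ⟩ := mem_closure_iff_seq_limit.1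
    ((UniformSpace.Completion.denseRange_coe (α := TestSpace r₀ b hb)) U)
  choose ψ hψ using hφ.1
  have hlim : Tendsto (fun n => (ψ n : H1 r₀ b hb)) atTop (𝓝 U) := by
    simpa only [hψ] using hφ.2
  have h1 := ((H1.toL2 r₀ b hb).continuous.tendsto U).comp hlim
  have h2 := ((H1.deriv r₀ b hb).continuous.tendsto U).comp hlim
  -- A subsequence of the approximating test functions converges almost everywhere. It also
  -- converges pointwise to the primitive, because evaluating `prim` at `r > 0` is a continuous
  -- functional of the weak derivative.
  obtain ⟨σ, hσ, hae⟩ := (tendstoInMeasure_of_tendsto_Lp h1).exists_seq_tendsto_ae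
  have hall : ∀ᵐ r ∂volume.restrict (Ioo 0 r₀), ∀ n, testToL2 r₀ b hb (ψ n) r = (ψ n).fn r :=
    ae_all_iff.2 fun n => testToL2_ae (ψ n)
  filter_upwards [ae_weightMeasure_one_iff.1 hae, hall, ae_restrict_mem measurableSet_Ioo]
    with r hr hr' hI
  refine tendsto_nhds_unique hr ?_
  have h3 : ∀ n, ((⇑(H1.toL2 r₀ b hb) ∘ fun n => (ψ n : H1 r₀ b hb)) (σ n) : WeightedL2 r₀ 1) r
      = -inner ℂ (kernel hI.1 r₀) (H1.deriv r₀ b hb (ψ (σ n) : H1 r₀ b hb)) := fun n => by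
    rw [Function.comp_apply, H1.toL2_coe, hr', H1.deriv_coe, ← prim_eq_inner hI.1 hI.2.le,
      prim_testDeriv _ ⟨hI.1, hI.2.le⟩]
  simp only [h3]
  rw [prim_eq_inner hI.1 hI.2.le]
  exact ((tendsto_const_nhds.inner h2).comp hσ.tendsto_atTop).neg

/-- Dividing by `r²` is harmless on the support of a test function, and turns the singular integral
with weight `r⁻¹` into an `L²(I, 1)` scalar product, continuous in its other factor. -/
theorem TestSpace.memLp_div_sq (φ : TestSpace r₀ b hb) :
    MemLp (fun r : ℝ => ((r ^ 2)⁻¹ : ℂ) * φ.fn r) 2 (weightMeasure r₀ 1) := by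
  refine Continuous.memLp_of_hasCompactSupport ?_ φ.hasCompactSupport.mul_left
  refine continuous_of_tsupport fun x hx => ?_
  have hx' : x ∈ tsupport φ.fn := by
    refine closure_mono (fun y hy hy' => ?_) hx
    exact hy (by simp [hy'])
  have hx0 : ((x : ℂ) ^ 2) ≠ 0 := by exact_mod_cast (pow_pos (φ.tsupport_subset hx').1 2).ne'
  exact (((Complex.continuous_ofReal.pow 2).continuousAt).inv₀ hx0).mul
    φ.contDiff.continuous.continuousAt

/-- The scalar product of `H₁(b)` with a test function. -/
theorem H1.inner_coe (φ : TestSpace r₀ b hb) (U : H1 r₀ b hb) :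
    inner ℂ (φ : H1 r₀ b hb) U
      = (∫ r in Ioo 0 r₀, (r : ℂ) * (H1.deriv r₀ b hb U r * conj (_root_.deriv φ.fn r)))
        - b * ∫ r in Ioo 0 r₀, (r : ℂ)⁻¹ * (H1.toL2 r₀ b hb U r * conj (φ.fn r)) := by
  have e1 : ∀ g : WeightedL2 r₀ 1, ∫ r in Ioo 0 r₀, (r : ℂ) * (g r * conj (_root_.deriv φ.fn r))
      = inner ℂ (testDeriv r₀ b hb φ) g := fun g => by
    rw [WeightedL2.inner_eq]
    refine integral_congr_ae ?_
    filter_upwards [testDeriv_ae φ] with r hr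
    rw [hr]
  have e2 : ∀ g : WeightedL2 r₀ 1, ∫ r in Ioo 0 r₀, (r : ℂ)⁻¹ * (g r * conj (φ.fn r))
      = inner ℂ (φ.memLp_div_sq.toLp _) g := fun g => by
    rw [WeightedL2.inner_eq]
    refine integral_congr_ae ?_
    filter_upwards [ae_weightMeasure_one_iff.1 φ.memLp_div_sq.coeFn_toLp,
      ae_restrict_mem measurableSet_Ioo] with r hr hI
    have : (r : ℂ) ≠ 0 := by exact_mod_cast hI.1.ne'
    rw [hr]
    simp only [map_mul, map_inv₀, map_pow, Complex.conj_ofReal]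
    field_simp
  rw [e1, e2]
  induction U using UniformSpace.Completion.induction_on with
  | hp => exact isClosed_eq (by fun_prop) (by fun_prop)
  | ih ψ =>
    rw [← e1, ← e2, UniformSpace.Completion.inner_coe, H1.deriv_coe, H1.toL2_coe]
    change form1 ψ φ = _
    unfold form1
    congr 1
    · refine integral_congr_ae ?_
      filter_upwards [testDeriv_ae ψ] with r hr
      rw [hr]
    · congr 1
      refine integral_congr_ae ?_
      filter_upwards [testToL2_ae ψ] with r hr
      rw [hr]

/-- `H₁(b)` is determined by test functions. -/
theorem H1.ext_inner {U V : H1 r₀ b hb}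
    (h : ∀ φ : TestSpace r₀ b hb, inner ℂ (φ : H1 r₀ b hb) U = inner ℂ (φ : H1 r₀ b hb) V) :
    U = V := by
  refine ext_inner_left ℂ fun W => ?_
  induction W using UniformSpace.Completion.induction_on with
  | hp => exact isClosed_eq (by fun_prop) (by fun_prop)
  | ih φ => exact h φ

/-- Lebesgue differentiation recovers `g` almost everywhere from its primitive. Integrability may
fail at `0`, so it is applied on the exhausting intervals `[r₀ / (n + 1), r₀]`. -/
theorem eq_zero_of_prim_eq_zero {g : WeightedL2 r₀ 1} (h : ∀ r ∈ Ioo 0 r₀, prim g r = 0) :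
    g = 0 := by
  rcases le_or_gt r₀ 0 with h0 | h0
  · rw [Lp.eq_zero_iff_ae_eq_zero]
    refine ae_weightMeasure_one_iff.2 ?_
    rw [Ioo_eq_empty (not_lt.2 h0), Measure.restrict_empty]
    simp
  have hpos : ∀ n : ℕ, 0 < r₀ / (n + 1) := fun n => by positivity
  have hle : ∀ n : ℕ, r₀ / (n + 1) ≤ r₀ := fun n =>
    div_le_self h0.le (by linarith [(n : ℕ).cast_nonneg (α := ℝ)])
  have hae : ∀ᵐ r : ℝ, ∀ n : ℕ, r ∈ uIcc (r₀ / (n + 1)) r₀ → ∀ c ∈ uIcc (r₀ / (n + 1)) r₀,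
      HasDerivAt (fun x => ∫ t in c..x, g t) (g r) r :=
    ae_all_iff.2 fun n => IntervalIntegrable.ae_hasDerivAt_integral
      (g.intervalIntegrable (hpos n) (hle n) le_rfl)
  rw [Lp.eq_zero_iff_ae_eq_zero]
  refine ae_weightMeasure_one_iff.2 ?_
  filter_upwards [ae_restrict_of_ae hae, ae_restrict_mem measurableSet_Ioo] with r hr hI
  obtain ⟨n, hn⟩ := exists_nat_gt (r₀ / r)
  have hrn : r₀ / (n + 1) ≤ r := by
    rw [div_lt_iff₀ hI.1] at hn
    rw [div_le_iff₀ (by positivity)]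
    nlinarith [hI.1]
  have h1 := hr n (by rw [uIcc_of_le (hle n)]; exact ⟨hrn, hI.2.le⟩) r₀ right_mem_uIcc
  have h2 : (fun x => ∫ t in r₀..x, g t) =ᶠ[𝓝 r] fun _ => 0 := by
    filter_upwards [Ioo_mem_nhds hI.1 hI.2] with x hx
    rw [intervalIntegral.integral_symm]
    exact h x hx
  exact (h1.congr_of_eventuallyEq h2.symm).unique (hasDerivAt_const r (0 : ℂ))

/-- Injectivity of an extension to a completion is not automatic. Here a vanishing function has a
vanishing continuous primitive, hence zero weak derivative, and then `H1.inner_coe` makes it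
orthogonal to all test functions. -/
theorem H1.toL2_injective : Function.Injective (H1.toL2 r₀ b hb) := by
  rw [injective_iff_map_eq_zero]
  intro U hU
  have h0 : ∀ᵐ r ∂volume.restrict (Ioo 0 r₀), H1.toL2 r₀ b hb U r = 0 := by
    rw [hU]
    exact ae_weightMeasure_one_iff.1 (Lp.coeFn_zero _ _ _)
  have h1 : EqOn (prim (H1.deriv r₀ b hb U)) (fun _ => 0) (Ioo 0 r₀) := by
    refine Measure.eqOn_open_of_ae_eq (μ := volume) ?_ isOpen_Ioo
      ((continuousOn_prim _).mono Ioo_subset_Ioc_self) continuousOn_const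
    filter_upwards [H1.toL2_ae U, h0] with r h1 h2
    rw [← h1, h2]
  have h2 : H1.deriv r₀ b hb U = 0 := eq_zero_of_prim_eq_zero h1
  refine H1.ext_inner fun φ => ?_
  rw [inner_zero_right, H1.inner_coe]
  have e1 : ∫ r in Ioo 0 r₀, (r : ℂ) * (H1.deriv r₀ b hb U r * conj (_root_.deriv φ.fn r)) = 0 := by
    refine integral_eq_zero_of_ae ?_
    rw [h2]
    filter_upwards [ae_weightMeasure_one_iff.1 (Lp.coeFn_zero ℂ 2 (weightMeasure r₀ 1))] with r hr
    rw [hr]; simp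
  have e2 : ∫ r in Ioo 0 r₀, (r : ℂ)⁻¹ * (H1.toL2 r₀ b hb U r * conj (φ.fn r)) = 0 := by
    refine integral_eq_zero_of_ae ?_
    filter_upwards [h0] with r hr
    rw [hr]; simp
  rw [e1, e2]; simp

/-- A real test function as an element of `TestSpace`. -/
noncomputable def TestSpace.ofReal {ψ : ℝ → ℝ} (h1 : ContDiff ℝ ∞ ψ) (h2 : HasCompactSupport ψ)
    (h3 : tsupport ψ ⊆ Ioo 0 r₀) : TestSpace r₀ b hb :=
  ⟨fun r => (ψ r : ℂ), Complex.ofRealCLM.contDiff.comp h1,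
    h2.comp_left (g := fun x : ℝ => (x : ℂ)) Complex.ofReal_zero,
    (closure_mono fun x (hx : (ψ x : ℂ) ≠ 0) (hx' : ψ x = 0) => hx (by simp [hx'])).trans h3⟩

theorem TestSpace.fn_ofReal {ψ : ℝ → ℝ} (h1 : ContDiff ℝ ∞ ψ) (h2 : HasCompactSupport ψ)
    (h3 : tsupport ψ ⊆ Ioo 0 r₀) :
    (TestSpace.ofReal h1 h2 h3 : TestSpace r₀ b hb).fn = fun r => (ψ r : ℂ) := rfl

theorem TestSpace.deriv_ofReal {ψ : ℝ → ℝ} (h1 : ContDiff ℝ ∞ ψ) (h2 : HasCompactSupport ψ)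
    (h3 : tsupport ψ ⊆ Ioo 0 r₀) (r : ℝ) :
    _root_.deriv (TestSpace.ofReal h1 h2 h3 : TestSpace r₀ b hb).fn r
      = ((_root_.deriv ψ r : ℝ) : ℂ) := by
  rw [TestSpace.fn_ofReal]
  exact ((h1.differentiable (by simp) r).hasDerivAt.ofReal_comp).deriv

/-- A function orthogonal to all real test functions vanishes almost everywhere. -/
theorem H1.denseRange_toL2 : DenseRange (H1.toL2 r₀ b hb) := by
  refine (Submodule.dense_iff_topologicalClosure_eq_top
    (s := (H1.toL2 r₀ b hb).toLinearMap.range)).2 ?_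
  rw [Submodule.topologicalClosure_eq_top_iff, Submodule.eq_bot_iff]
  intro w hw
  rw [Submodule.mem_orthogonal] at hw
  have hint : IntegrableOn (fun r => r • w r) (Ioo 0 r₀) :=
    (integrable_weightMeasure_one_iff _).1 ((Lp.memLp w).integrable (by norm_num))
  have h0 := isOpen_Ioo.ae_eq_zero_of_integral_contDiff_smul_eq_zero (μ := volume)
    hint.locallyIntegrableOn fun ψ h1 h2 h3 => ?_
  · rw [Lp.eq_zero_iff_ae_eq_zero]
    refine ae_weightMeasure_one_iff.2 ?_
    rw [ae_restrict_iff' measurableSet_Ioo]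
    filter_upwards [h0] with r hr hI
    exact (smul_eq_zero.1 (hr hI)).resolve_left hI.1.ne'
  · have h4 := hw _ ⟨(TestSpace.ofReal h1 h2 h3 : TestSpace r₀ b hb), rfl⟩
    rw [ContinuousLinearMap.coe_coe, H1.toL2_coe, WeightedL2.inner_eq] at h4
    rw [← setIntegral_eq_integral_of_forall_compl_eq_zero (s := Ioo 0 r₀), ← h4]
    · refine integral_congr_ae ?_
      filter_upwards [testToL2_ae (TestSpace.ofReal h1 h2 h3 : TestSpace r₀ b hb)] with r hr
      rw [hr, TestSpace.fn_ofReal]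
      simp only [Complex.conj_ofReal, Complex.real_smul]
      ring
    · intro r hr
      rw [image_eq_zero_of_notMem_tsupport fun h => hr (h3 h), zero_smul]

end Sobolev

/-! ### Compactness of the embedding and the interpolation inequality -/

section Compactness

variable {r₀ b : ℝ} {hb : b ≤ 0}

theorem gridPoint_pos (hr₀ : 0 < r₀) (N k : ℕ) : 0 < r₀ / (N + 1) * (k + 1) := by positivity

/-- The approximation of elements of `H₁(b)` by step functions with `N + 1` steps. -/
noncomputable def stepApprox (b : ℝ) (hb : b ≤ 0) (hr₀ : 0 < r₀) (N : ℕ) :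
    H1 r₀ b hb →L[ℂ] WeightedL2 r₀ 1 :=
  ∑ k ∈ Finset.range (N + 1),
    (-((innerSL ℂ (kernel (r₀ := r₀) (gridPoint_pos hr₀ N k) r₀)) ∘L
      H1.deriv r₀ b hb)).smulRight
      (indicatorConstLp 2 (measurableSet_Ioc (a := r₀ / (N + 1) * k) (b := r₀ / (N + 1) * (k + 1)))
        (measure_ne_top _ _) (1 : ℂ))

/-- Each summand factors through `ℂ`, so the operator has finite rank. -/
theorem isCompactOperator_stepApprox (hr₀ : 0 < r₀) (N : ℕ) :
    IsCompactOperator (stepApprox b hb hr₀ N) := by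
  have h : ∀ k ∈ Finset.range (N + 1), (-((innerSL ℂ (kernel (r₀ := r₀) (gridPoint_pos hr₀ N k)
      r₀)) ∘L H1.deriv r₀ b hb)).smulRight
      (indicatorConstLp 2 (measurableSet_Ioc (a := r₀ / (N + 1) * k) (b := r₀ / (N + 1) * (k + 1)))
        (measure_ne_top _ _) (1 : ℂ)) ∈ compactOperator (RingHom.id ℂ) (H1 r₀ b hb)
          (WeightedL2 r₀ 1) := fun k _ => by
    have h1 := isCompactOperator_of_locallyCompactSpace_rng (ContinuousLinearMap.toSpanSingleton ℂ
      (indicatorConstLp (μ := weightMeasure r₀ 1) 2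
        (measurableSet_Ioc (a := r₀ / (N + 1) * k) (b := r₀ / (N + 1) * (k + 1)))
        (measure_ne_top _ _) (1 : ℂ)))
    exact h1.comp_clm (-((innerSL ℂ (kernel (r₀ := r₀) (gridPoint_pos hr₀ N k) r₀)) ∘L
      H1.deriv r₀ b hb))
  exact Submodule.sum_mem _ h

/-- The point `s` is the right end of the grid cell containing `r`. Right ends are sampled because
the left end of the first cell is `0`, where the primitive is not controlled. -/
theorem stepApprox_ae (hr₀ : 0 < r₀) (N : ℕ) (U : H1 r₀ b hb) :
    ∀ᵐ r ∂volume.restrict (Ioo 0 r₀), ∃ s, r ≤ s ∧ s ≤ r₀ ∧ s - r ≤ r₀ / (N + 1) ∧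
      stepApprox b hb hr₀ N U r = prim (H1.deriv r₀ b hb U) s := by
  set h : ℝ := r₀ / (N + 1) with hh
  have hpos : 0 < h := by positivity
  have e1 : stepApprox b hb hr₀ N U = ∑ k ∈ Finset.range (N + 1),
      (-inner ℂ (kernel (r₀ := r₀) (gridPoint_pos hr₀ N k) r₀) (H1.deriv r₀ b hb U)) •
      (indicatorConstLp 2 (measurableSet_Ioc (a := h * k) (b := h * (k + 1)))
        (measure_ne_top _ _) (1 : ℂ)) := by
    simp [stepApprox, hh]
  have e2 := Lp.coeFn_fun_finsetSum (Finset.range (N + 1)) fun k : ℕ =>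
      (-inner ℂ (kernel (r₀ := r₀) (gridPoint_pos hr₀ N k) r₀) (H1.deriv r₀ b hb U)) •
      (indicatorConstLp (μ := weightMeasure r₀ 1) 2
        (measurableSet_Ioc (a := h * k) (b := h * (k + 1))) (measure_ne_top _ _) (1 : ℂ))
  have e3 : ∀ᵐ r ∂weightMeasure r₀ 1, ∀ k : ℕ,
      ((-inner ℂ (kernel (r₀ := r₀) (gridPoint_pos hr₀ N k) r₀) (H1.deriv r₀ b hb U)) •
      (indicatorConstLp (μ := weightMeasure r₀ 1) 2
        (measurableSet_Ioc (a := h * k) (b := h * (k + 1))) (measure_ne_top _ _) (1 : ℂ))) r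
      = (-inner ℂ (kernel (r₀ := r₀) (gridPoint_pos hr₀ N k) r₀) (H1.deriv r₀ b hb U)) •
        (Ioc (h * k) (h * (k + 1))).indicator (fun _ => (1 : ℂ)) r := by
    refine ae_all_iff.2 fun k => ?_
    filter_upwards [Lp.coeFn_smul (-inner ℂ (kernel (r₀ := r₀) (gridPoint_pos hr₀ N k) r₀)
      (H1.deriv r₀ b hb U)) (indicatorConstLp (μ := weightMeasure r₀ 1) 2
        (measurableSet_Ioc (a := h * k) (b := h * (k + 1))) (measure_ne_top _ _) (1 : ℂ)),
      indicatorConstLp_coeFn (μ := weightMeasure r₀ 1) (p := 2)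
        (hs := measurableSet_Ioc (a := h * k) (b := h * (k + 1)))
        (hμs := measure_ne_top _ _) (c := (1 : ℂ))] with r h1 h2
    rw [h1, Pi.smul_apply, h2]
  filter_upwards [ae_weightMeasure_one_iff.1 e2, ae_weightMeasure_one_iff.1 e3,
    ae_restrict_mem measurableSet_Ioo] with r h2 h3 hI
  -- Cells are open on the left and closed on the right, hence the ceiling; `m` is one less because
  -- cells are counted from zero.
  obtain ⟨m, hm⟩ : ∃ m : ℕ, ⌈r / h⌉₊ = m + 1 :=
    Nat.exists_eq_succ_of_ne_zero (Nat.ceil_pos.2 (div_pos hI.1 hpos)).ne'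
  have hle : r ≤ h * (m + 1) := by
    have := Nat.le_ceil (r / h)
    rw [hm, div_le_iff₀ hpos] at this
    push_cast at this
    linarith
  have hlt : h * m < r := by
    have : (m : ℕ) < ⌈r / h⌉₊ := by omega
    rw [Nat.lt_ceil, lt_div_iff₀ hpos] at this
    linarith
  have hmN : m < N + 1 := by
    by_contra hcon
    have h5 : ((N : ℝ) + 1) ≤ m := by exact_mod_cast not_lt.1 hcon
    have h6 : h * (N + 1) = r₀ := by rw [hh]; field_simp
    have h7 := mul_le_mul_of_nonneg_left h5 hpos.le
    linarith [hI.2]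
  have hsr : h * (m + 1) ≤ r₀ := by
    have h5 : ((m : ℝ) + 1) ≤ N + 1 := by exact_mod_cast hmN
    have h6 : h * (N + 1) = r₀ := by rw [hh]; field_simp
    have h7 := mul_le_mul_of_nonneg_left h5 hpos.le
    linarith
  refine ⟨h * (m + 1), hle, hsr, by linarith, ?_⟩
  rw [e1, h2, Finset.sum_eq_single m]
  · rw [h3, indicator_of_mem (show r ∈ Ioc (h * m) (h * (m + 1)) from ⟨hlt, hle⟩),
      prim_eq_inner (gridPoint_pos hr₀ N m) hsr]
    simp
  · intro k _ hkm
    rw [h3, indicator_of_notMem, smul_zero]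
    rintro ⟨h5, h6⟩
    rcases lt_or_gt_of_ne hkm with h7 | h7
    · have h8 : ((k : ℝ) + 1) ≤ m := by exact_mod_cast h7
      have := mul_le_mul_of_nonneg_left h8 hpos.le
      linarith
    · have h8 : ((m : ℝ) + 1) ≤ k := by exact_mod_cast h7
      have := mul_le_mul_of_nonneg_left h8 hpos.le
      linarith
  · intro h5
    exact absurd (Finset.mem_range.2 hmN) h5

/-- By `norm_prim_sub_sq_le` the weighted squared error is at most the cell width times `‖U‖²`
pointwise; integrating over the interval adds the factor `r₀`. -/
theorem norm_stepApprox_sub_le (hr₀ : 0 < r₀) (N : ℕ) :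
    ‖stepApprox b hb hr₀ N - H1.toL2 r₀ b hb‖ ≤ √(r₀ / (N + 1) * r₀) := by
  refine ContinuousLinearMap.opNorm_le_bound _ (Real.sqrt_nonneg _) fun U => ?_
  refine abs_le_of_sq_le_sq' ?_ (by positivity) |>.2
  rw [mul_pow, Real.sq_sqrt (by positivity), WeightedL2.norm_sq_eq]
  have h1 : ∀ᵐ r ∂volume.restrict (Ioo 0 r₀),
      r * ‖((stepApprox b hb hr₀ N - H1.toL2 r₀ b hb) U : WeightedL2 r₀ 1) r‖ ^ 2
        ≤ r₀ / (N + 1) * ‖U‖ ^ 2 := by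
    filter_upwards [stepApprox_ae hr₀ N U, H1.toL2_ae U, ae_restrict_mem measurableSet_Ioo,
      ae_weightMeasure_one_iff.1 (Lp.coeFn_sub (stepApprox b hb hr₀ N U) (H1.toL2 r₀ b hb U))]
      with r hr hr' hI h4
    obtain ⟨s, hrs, hs, hsr, hval⟩ := hr
    rw [sub_apply, h4, Pi.sub_apply, hval, hr']
    refine (norm_prim_sub_sq_le hI.1 hrs hs _).trans ?_
    exact mul_le_mul hsr (pow_le_pow_left₀ (norm_nonneg _) (H1.norm_deriv_le U) 2)
      (sq_nonneg _) (by positivity)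
  refine (integral_mono_ae (WeightedL2.integrableOn_norm_sq _) (integrable_const _) h1).trans ?_
  rw [setIntegral_const, Measure.real, Real.volume_Ioo, sub_zero, ENNReal.toReal_ofReal hr₀.le,
    smul_eq_mul]
  exact le_of_eq (by ring)

/-- The embedding `H₁(b) → L²(I, 1)` is compact. -/
theorem H1.isCompactOperator_toL2 (hr₀ : 0 < r₀) : IsCompactOperator (H1.toL2 r₀ b hb) := by
  have h : Tendsto (stepApprox b hb hr₀) atTop (𝓝 (H1.toL2 r₀ b hb)) := by
    refine (tendsto_iff_norm_sub_tendsto_zero (E := H1 r₀ b hb →L[ℂ] WeightedL2 r₀ 1)).2 ?_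
    refine squeeze_zero (fun _ => ContinuousLinearMap.opNorm_nonneg _)
      (norm_stepApprox_sub_le hr₀) ?_
    have h1 : Tendsto (fun N : ℕ => r₀ / ((N : ℝ) + 1) * r₀) atTop (𝓝 0) := by
      simpa using ((tendsto_const_div_atTop_nhds_zero_nat r₀).comp
        (tendsto_add_atTop_nat 1)).mul_const r₀
    simpa using h1.sqrt
  exact isCompactOperator_of_tendsto h (Eventually.of_forall (isCompactOperator_stepApprox hr₀))

theorem norm_prim_sq_le {r : ℝ} (hI : r ∈ Ioo 0 r₀) (g : WeightedL2 r₀ 1) :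
    r * ‖prim g r‖ ^ 2 ≤ r₀ * ‖g‖ ^ 2 := by
  have h1 := norm_prim_sub_sq_le hI.1 hI.2.le le_rfl g
  rw [prim_right, zero_sub, norm_neg] at h1
  nlinarith [hI.1, sq_nonneg ‖g‖]

theorem WeightedL2.integrableOn_pow_norm_sq (f : WeightedL2 r₀ 1) :
    IntegrableOn (fun r => r ^ 3 * ‖f r‖ ^ 2) (Ioo 0 r₀) := by
  have h := Integrable.bdd_smul (φ := fun t : ℝ => t ^ 2) f.integrableOn_norm_sq (r₀ ^ 2)
    (by fun_prop : Measurable fun t : ℝ => t ^ 2).aestronglyMeasurable ?_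
  · refine h.congr (ae_of_all _ fun r => ?_)
    simp only [Pi.smul_apply', smul_eq_mul]
    ring
  · filter_upwards [ae_restrict_mem measurableSet_Ioo] with r hI
    rw [norm_pow, Real.norm_of_nonneg hI.1.le]
    exact pow_le_pow_left₀ hI.1.le hI.2.le 2

/-- An interpolation inequality: the `L²(I, 1)` norm is small relative to `H₁(b)` up to a multiple
of the `L²(I, 3)` norm. -/
theorem H1.norm_toL2_sq_le (hr₀ : 0 < r₀) {ε : ℝ} (hε : 0 < ε) :
    ∃ c, 0 ≤ c ∧ ∀ U : H1 r₀ b hb, ‖H1.toL2 r₀ b hb U‖ ^ 2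
      ≤ ε * ‖U‖ ^ 2 + c * ∫ r in Ioo 0 r₀, r ^ 3 * ‖H1.toL2 r₀ b hb U r‖ ^ 2 := by
  -- On `(0, δ)` the integrand is at most `r₀ ‖U‖²`, contributing `δ r₀ ‖U‖² = ε ‖U‖²`; for `r ≥ δ`
  -- one has `r ≤ δ⁻² r³`, whence the constant.
  set δ := ε / r₀ with hδ
  have hδ0 : 0 < δ := by positivity
  refine ⟨(δ ^ 2)⁻¹, by positivity, fun U => ?_⟩
  have hi1 := (H1.toL2 r₀ b hb U).integrableOn_pow_norm_sq.const_mul ((δ ^ 2)⁻¹)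
  have hi2 : IntegrableOn ((Ioo 0 δ).indicator fun _ : ℝ => r₀ * ‖U‖ ^ 2) (Ioo 0 r₀) :=
    (integrable_const _).indicator measurableSet_Ioo
  rw [WeightedL2.norm_sq_eq]
  have h1 : ∀ᵐ r ∂volume.restrict (Ioo 0 r₀), r * ‖H1.toL2 r₀ b hb U r‖ ^ 2
      ≤ (Ioo 0 δ).indicator (fun _ : ℝ => r₀ * ‖U‖ ^ 2) r
        + (δ ^ 2)⁻¹ * (r ^ 3 * ‖H1.toL2 r₀ b hb U r‖ ^ 2) := by
    filter_upwards [H1.toL2_ae U, ae_restrict_mem measurableSet_Ioo] with r hr hI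
    have hn : 0 ≤ r * ‖H1.toL2 r₀ b hb U r‖ ^ 2 := mul_nonneg hI.1.le (sq_nonneg _)
    have e : (δ ^ 2)⁻¹ * (r ^ 3 * ‖H1.toL2 r₀ b hb U r‖ ^ 2)
        = ((δ ^ 2)⁻¹ * r ^ 2) * (r * ‖H1.toL2 r₀ b hb U r‖ ^ 2) := by ring
    rw [e]
    by_cases hrδ : r ∈ Ioo 0 δ
    · rw [indicator_of_mem hrδ]
      have h2 := norm_prim_sq_le hI (H1.deriv r₀ b hb U)
      rw [← hr] at h2
      have h3 : r₀ * ‖H1.deriv r₀ b hb U‖ ^ 2 ≤ r₀ * ‖U‖ ^ 2 :=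
        mul_le_mul_of_nonneg_left (pow_le_pow_left₀ (norm_nonneg _) (H1.norm_deriv_le U) 2) hr₀.le
      have h4 : 0 ≤ (δ ^ 2)⁻¹ * r ^ 2 := by positivity
      nlinarith [mul_nonneg h4 hn]
    · rw [indicator_of_notMem hrδ, zero_add]
      have h5 : δ ≤ r := by
        by_contra hcon
        exact hrδ ⟨hI.1, not_le.1 hcon⟩
      have h6 : 1 ≤ (δ ^ 2)⁻¹ * r ^ 2 := by
        rw [inv_mul_eq_div, le_div_iff₀ (by positivity), one_mul]
        exact pow_le_pow_left₀ hδ0.le h5 2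
      exact le_mul_of_one_le_left hn h6
  refine (integral_mono_ae (WeightedL2.integrableOn_norm_sq _) (hi2.add hi1) h1).trans ?_
  simp only [Pi.add_apply]
  rw [integral_add hi2 hi1, integral_const_mul]
  gcongr
  rw [setIntegral_indicator measurableSet_Ioo, setIntegral_const, smul_eq_mul]
  have h7 : volume.real (Ioo 0 r₀ ∩ Ioo 0 δ) ≤ δ := by
    have := measureReal_mono (μ := volume) (inter_subset_right : Ioo 0 r₀ ∩ Ioo 0 δ ⊆ Ioo 0 δ)
      (by simp)
    rwa [Measure.real, Measure.real, Real.volume_Ioo, sub_zero, ENNReal.toReal_ofReal hδ0.le]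
      at this
  calc _ ≤ δ * (r₀ * ‖U‖ ^ 2) := mul_le_mul_of_nonneg_right h7 (by positivity)
    _ = ε * ‖U‖ ^ 2 := by rw [hδ]; field_simp

end Compactness

/-! ### Multiplication operators -/

section Multiplication

variable {r₀ : ℝ} {q : ℝ → ℝ}

theorem memLp_top_ofReal (hq : Continuous q) :
    MemLp (fun r => (q r : ℂ)) ⊤ (weightMeasure r₀ 1) := by
  obtain ⟨C, hC⟩ := (isCompact_Icc (a := 0) (b := r₀)).exists_bound_of_continuousOn hq.continuousOn
  refine memLp_top_of_bound (by fun_prop) C (ae_weightMeasure_one_iff.2 ?_)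
  filter_upwards [ae_restrict_mem measurableSet_Ioo] with r hr
  rw [Complex.norm_real]
  exact hC r (Ioo_subset_Icc_self hr)

/-- Multiplication by a continuous real function on `L²(I, 1)`. -/
noncomputable def mulOp (r₀ : ℝ) (hq : Continuous q) : WeightedL2 r₀ 1 →L[ℂ] WeightedL2 r₀ 1 :=
  (ContinuousLinearMap.mul ℂ ℂ).holderL (weightMeasure r₀ 1) ⊤ 2 2 (memLp_top_ofReal hq).toLp

theorem mulOp_ae (hq : Continuous q) (f : WeightedL2 r₀ 1) :
    ∀ᵐ r ∂volume.restrict (Ioo 0 r₀), mulOp r₀ hq f r = (q r : ℂ) * f r := by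
  have h1 := (ContinuousLinearMap.mul ℂ ℂ).coeFn_holder (r := 2)
    ((memLp_top_ofReal (r₀ := r₀) hq).toLp) f
  filter_upwards [ae_weightMeasure_one_iff.1 h1,
    ae_weightMeasure_one_iff.1 (memLp_top_ofReal (r₀ := r₀) hq).coeFn_toLp] with r h1 h2
  rw [← h2]
  exact h1

theorem inner_mulOp (hq : Continuous q) (f g : WeightedL2 r₀ 1) :
    inner ℂ g (mulOp r₀ hq f) = ∫ r in Ioo 0 r₀, ((r * q r : ℝ) : ℂ) * (f r * conj (g r)) := by
  rw [WeightedL2.inner_eq]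
  refine integral_congr_ae ?_
  filter_upwards [mulOp_ae hq f] with r hr
  rw [hr]; push_cast; ring

theorem isSelfAdjoint_mulOp (hq : Continuous q) : IsSelfAdjoint (mulOp r₀ hq) := by
  rw [ContinuousLinearMap.isSelfAdjoint_iff_isSymmetric]
  intro f g
  change inner ℂ (mulOp r₀ hq f) g = inner ℂ f (mulOp r₀ hq g)
  rw [inner_mulOp, WeightedL2.inner_eq]
  refine integral_congr_ae ?_
  filter_upwards [mulOp_ae hq f] with r hr
  rw [hr, map_mul, Complex.conj_ofReal]; push_cast; ring

theorem inner_mulOp_self (hq : Continuous q) (f : WeightedL2 r₀ 1) :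
    inner ℂ f (mulOp r₀ hq f) = ((∫ r in Ioo 0 r₀, r * q r * ‖f r‖ ^ 2 : ℝ) : ℂ) := by
  rw [inner_mulOp, ← integral_complex_ofReal]
  congr 1; ext r
  rw [Complex.mul_conj, Complex.normSq_eq_norm_sq]; push_cast; ring

end Multiplication

/-! ### The forms of potential and weight as operators on `H1` -/

section Operators

variable {r₀ b : ℝ} {hb : b ≤ 0} {q : ℝ → ℝ}

/-- The operator on `H₁(b)` representing the form `∫_I r q u conj(v)`. -/
noncomputable def formOp (b : ℝ) (hb : b ≤ 0) (r₀ : ℝ) (hq : Continuous q) :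
    H1 r₀ b hb →L[ℂ] H1 r₀ b hb :=
  (H1.toL2 r₀ b hb).adjoint ∘L mulOp r₀ hq ∘L H1.toL2 r₀ b hb

theorem inner_formOp (hq : Continuous q) (U V : H1 r₀ b hb) :
    inner ℂ V (formOp b hb r₀ hq U)
      = inner ℂ (H1.toL2 r₀ b hb V) (mulOp r₀ hq (H1.toL2 r₀ b hb U)) := by
  simp only [formOp, ContinuousLinearMap.comp_apply, ContinuousLinearMap.adjoint_inner_right]

theorem isSelfAdjoint_formOp (hq : Continuous q) : IsSelfAdjoint (formOp b hb r₀ hq) := by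
  rw [ContinuousLinearMap.isSelfAdjoint_iff_isSymmetric]
  intro U V
  change inner ℂ (formOp b hb r₀ hq U) V = inner ℂ U (formOp b hb r₀ hq V)
  rw [inner_formOp, ← inner_conj_symm, inner_formOp, inner_conj_symm]
  exact (isSelfAdjoint_mulOp hq).isSymmetric _ _

theorem isCompactOperator_formOp (hr₀ : 0 < r₀) (hq : Continuous q) :
    IsCompactOperator (formOp b hb r₀ hq) :=
  (H1.isCompactOperator_toL2 hr₀).clm_comp ((H1.toL2 r₀ b hb).adjoint ∘L mulOp r₀ hq)

theorem continuous_weight (a : ℝ) : Continuous fun r : ℝ => a * r ^ 2 := by fun_prop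

/-- Positivity of `K` is injectivity of the embedding plus positivity of the weight. For coercivity
the form of `Q` is at most `‖mulOp‖ ‖J U‖²`, which the interpolation inequality splits into half of
`‖U‖²` and a multiple of the `K`-form. -/
theorem exists_generalizedEigenproblem (hr₀ : 0 < r₀) (hq : Continuous q) {a : ℝ} (ha : 0 < a) :
    ∃ c, GeneralizedEigenproblem (formOp b hb r₀ hq) (formOp b hb r₀ (continuous_weight a)) c := by
  have hw : ∀ U : H1 r₀ b hb, RCLike.re (inner ℂ U (formOp b hb r₀ (continuous_weight a) U))
      = a * ∫ r in Ioo 0 r₀, r ^ 3 * ‖H1.toL2 r₀ b hb U r‖ ^ 2 := fun U => by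
    rw [inner_formOp, inner_mulOp_self, RCLike.re_to_complex, Complex.ofReal_re,
      ← integral_const_mul]
    congr 1; ext r; ring
  set M : ℝ := ‖mulOp r₀ hq‖ with hM
  -- Chosen so that `(M + 1) ε = 1 / 2`; using `M + 1` instead of `M` avoids a division by zero.
  obtain ⟨c, hc0, hc⟩ := H1.norm_toL2_sq_le (b := b) (hb := hb) hr₀
    (ε := 1 / (2 * (M + 1))) (by positivity)
  refine ⟨(M + 1) * c / a, isSelfAdjoint_formOp _, isSelfAdjoint_formOp _,
    isCompactOperator_formOp hr₀ _, fun U hU => ?_, fun U => ?_⟩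
  · rw [hw]
    refine mul_pos ha ?_
    have hnn : 0 ≤ᵐ[volume.restrict (Ioo 0 r₀)]
        fun r => r ^ 3 * ‖H1.toL2 r₀ b hb U r‖ ^ 2 := by
      filter_upwards [ae_restrict_mem measurableSet_Ioo] with r hr
      exact mul_nonneg (pow_nonneg hr.1.le 3) (sq_nonneg _)
    refine lt_of_le_of_ne (integral_nonneg_of_ae hnn) fun h0 => hU ?_
    have h1 := (integral_eq_zero_iff_of_nonneg_ae hnn
      (WeightedL2.integrableOn_pow_norm_sq _)).1 h0.symm
    refine H1.toL2_injective ?_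
    rw [map_zero, Lp.eq_zero_iff_ae_eq_zero]
    refine ae_weightMeasure_one_iff.2 ?_
    filter_upwards [h1, ae_restrict_mem measurableSet_Ioo] with r hr hI
    have h2 := (mul_eq_zero.1 hr).resolve_left (pow_pos hI.1 3).ne'
    exact norm_eq_zero.1 (pow_eq_zero_iff two_ne_zero |>.1 h2)
  · have h1 : |RCLike.re (inner ℂ U (formOp b hb r₀ hq U))| ≤ M * ‖H1.toL2 r₀ b hb U‖ ^ 2 := by
      rw [inner_formOp]
      refine (RCLike.abs_re_le_norm _).trans ((norm_inner_le_norm _ _).trans ?_)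
      have := (mulOp r₀ hq).le_opNorm (H1.toL2 r₀ b hb U)
      nlinarith [norm_nonneg (H1.toL2 r₀ b hb U)]
    have h2 := neg_le_of_abs_le h1
    rw [inner_add_right, inner_add_right, inner_smul_right, map_add, map_add,
      inner_self_eq_norm_sq, RCLike.re_to_complex, RCLike.re_to_complex, Complex.re_ofReal_mul,
      ← RCLike.re_to_complex, ← RCLike.re_to_complex, hw]
    have h3 := hc U
    set I := ∫ r in Ioo 0 r₀, r ^ 3 * ‖H1.toL2 r₀ b hb U r‖ ^ 2
    have hI : 0 ≤ I := setIntegral_nonneg measurableSet_Ioo fun r hr =>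
      mul_nonneg (pow_nonneg hr.1.le 3) (sq_nonneg _)
    have hM0 : 0 ≤ M := norm_nonneg _
    have h4 : (M + 1) * c / a * (a * I) = (M + 1) * (c * I) := by field_simp
    have h5 : (M + 1) * (1 / (2 * (M + 1)) * ‖U‖ ^ 2) = 1 / 2 * ‖U‖ ^ 2 := by field_simp
    rw [h4]
    have h6 : M * ‖H1.toL2 r₀ b hb U‖ ^ 2 ≤ (M + 1) * ‖H1.toL2 r₀ b hb U‖ ^ 2 := by
      nlinarith [sq_nonneg ‖H1.toL2 r₀ b hb U‖]
    have h7 := mul_le_mul_of_nonneg_left h3 (by positivity : 0 ≤ M + 1)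
    rw [mul_add, h5] at h7
    linarith

theorem solvesEigenvalueProblem_iff (n : ℕ) (Vb κ Λ : ℝ)
    (hq : Continuous fun r : ℝ => -(16 / (n : ℝ) ^ 2 * Vb * r ^ 2)
            + 16 / (n : ℝ) ^ 2 * κ * r ^ (2 * ((n : ℝ) - 2) / n)) (U : H1 r₀ b hb) :
    SolvesEigenvalueProblem n Vb κ Λ U ↔
      IsSol (formOp b hb r₀ hq) (formOp b hb r₀ (continuous_weight (16 / (n : ℝ) ^ 2))) Λ U := by
  have h : ∀ v, (inner ℂ v U
      + ∫ r in Ioo 0 r₀, ((r * (-(16 / n ^ 2 * Vb * r ^ 2)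
            + 16 / n ^ 2 * κ * r ^ (2 * ((n : ℝ) - 2) / n)) : ℝ) : ℂ)
          * (H1.toL2 r₀ b hb U r * conj (H1.toL2 r₀ b hb v r))
      = (Λ : ℂ) * ∫ r in Ioo 0 r₀, ((r * (16 / n ^ 2 * r ^ 2) : ℝ) : ℂ)
          * (H1.toL2 r₀ b hb U r * conj (H1.toL2 r₀ b hb v r))) ↔
      inner ℂ v (U + formOp b hb r₀ hq U)
        = inner ℂ v ((Λ : ℂ) • formOp b hb r₀ (continuous_weight (16 / (n : ℝ) ^ 2)) U) :=
      fun v => by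
    rw [inner_add_right, inner_smul_right, inner_formOp, inner_formOp, inner_mulOp, inner_mulOp]
  constructor
  · intro hU
    exact ext_inner_left ℂ fun v => (h v).1 (hU v)
  · intro hU v
    exact (h v).2 (by rw [show U + _ = _ from hU])

/-- In a nonzero finite-dimensional complex space every operator has an eigenvalue, but
multiplication by `r` has none: an eigenfunction would be supported at a single point. -/
theorem not_finiteDimensional_weightedL2 (hr₀ : 0 < r₀) :
    ¬ FiniteDimensional ℂ (WeightedL2 r₀ 1) := by
  intro hfd
  have hne : (kernel (half_pos hr₀) r₀ : WeightedL2 r₀ 1) ≠ 0 := by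
    intro h0
    have h1 := norm_kernel_sq (half_pos hr₀) (half_le_self hr₀.le) le_rfl
    rw [h0, norm_zero, div_div_cancel₀ hr₀.ne'] at h1
    have := Real.log_pos one_lt_two
    norm_num at h1
    exact this.ne h1
  have : Nontrivial (WeightedL2 r₀ 1) := ⟨_, 0, hne⟩
  obtain ⟨z, hz⟩ := Module.End.exists_eigenvalue
    ((mulOp r₀ continuous_id).toLinearMap : Module.End ℂ (WeightedL2 r₀ 1))
  obtain ⟨f, hf, hf0⟩ := hz.exists_hasEigenvector
  refine hf0 ?_
  have h1 : mulOp r₀ continuous_id f = z • f := Module.End.mem_eigenspace_iff.1 hf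
  rw [Lp.eq_zero_iff_ae_eq_zero]
  refine ae_weightMeasure_one_iff.2 ?_
  have h2 := ae_weightMeasure_one_iff.1 (Lp.coeFn_smul z f)
  have h3 : ∀ᵐ r ∂volume.restrict (Ioo 0 r₀), r ≠ z.re :=
    ae_restrict_of_ae (Measure.ae_ne volume z.re)
  filter_upwards [mulOp_ae continuous_id f, h2, h3] with r h4 h5 h6
  rw [h1, h5, Pi.smul_apply, smul_eq_mul] at h4
  have h7 : (z - r) * f r = 0 := by rw [sub_mul, h4]; simp
  refine (mul_eq_zero.1 h7).resolve_left fun h8 => h6 ?_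
  rw [sub_eq_zero.1 h8, Complex.ofReal_re]

/-- A finite-dimensional range would be closed, and being dense it would be all of `L²(I, 1)`. -/
theorem H1.not_finiteDimensional (hr₀ : 0 < r₀) : ¬ FiniteDimensional ℂ (H1 r₀ b hb) := by
  intro hfd
  refine not_finiteDimensional_weightedL2 hr₀ ?_
  have hr : (H1.toL2 r₀ b hb).toLinearMap.range = ⊤ := by
    rw [← (Submodule.closed_of_finiteDimensional
      (H1.toL2 r₀ b hb).toLinearMap.range).submodule_topologicalClosure_eq]
    exact Submodule.dense_iff_topologicalClosure_eq_top.1 H1.denseRange_toL2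
  exact Module.Finite.of_surjective _ (LinearMap.range_eq_top.1 hr)

end Operators

/-! ### Integration against test functions and the lemma of du Bois-Reymond -/

section TestIntegrals

variable {s : Set ℝ} {ψ : ℝ → ℝ} {f : ℝ → ℂ}

theorem continuous_smul_of_tsupport_subset (hs : IsOpen s) (h1 : Continuous ψ)
    (h3 : tsupport ψ ⊆ s) (hf : ContinuousOn f s) : Continuous fun x => ψ x • f x := by
  refine continuous_of_tsupport fun x hx => ?_
  have hx' : x ∈ s := h3 (closure_mono (Function.support_smul_subset_left ψ f) hx)
  exact h1.continuousAt.smul ((hf x hx').continuousAt (hs.mem_nhds hx'))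

theorem integrable_smul_of_tsupport_subset (hs : IsOpen s) (h1 : Continuous ψ)
    (h2 : HasCompactSupport ψ) (h3 : tsupport ψ ⊆ s) (hf : ContinuousOn f s) :
    Integrable fun x => ψ x • f x :=
  (continuous_smul_of_tsupport_subset hs h1 h3 hf).integrable_of_hasCompactSupport h2.smul_right

theorem tsupport_deriv_subset_tsupport : tsupport (deriv ψ) ⊆ tsupport ψ :=
  closure_minimal support_deriv_subset isClosed_closure

/-- Integration by parts against a test function. -/
theorem integral_deriv_smul_eq (hs : IsOpen s) (h1 : ContDiff ℝ ∞ ψ) (h2 : HasCompactSupport ψ)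
    (h3 : tsupport ψ ⊆ s) {f' : ℝ → ℂ} (hf : ∀ x ∈ s, HasDerivAt f (f' x) x)
    (hf' : ContinuousOn f' s) :
    ∫ x, deriv ψ x • f x = -∫ x, ψ x • f' x := by
  have hc : ContinuousOn f s := fun x hx => (hf x hx).continuousAt.continuousWithinAt
  have hd : ∀ x, HasDerivAt (fun x => ψ x • f x) (ψ x • f' x + deriv ψ x • f x) x := by
    intro x
    by_cases hx : x ∈ tsupport ψ
    · exact (h1.differentiable (by simp) x).hasDerivAt.smul (hf x (h3 hx))
    -- Off the support of `ψ` the product vanishes locally, whatever `f` does there.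
    · have h0 : ψ =ᶠ[𝓝 x] 0 := notMem_tsupport_iff_eventuallyEq.1 hx
      rw [h0.deriv_eq, h0.self_of_nhds]
      simp only [Pi.zero_apply, zero_smul, zero_add]
      have h4 : deriv (0 : ℝ → ℝ) x = 0 := deriv_const x (0 : ℝ)
      rw [h4, zero_smul]
      refine (hasDerivAt_const x (0 : ℂ)).congr_of_eventuallyEq ?_
      filter_upwards [h0] with y hy
      rw [hy]; simp
  have i1 := integrable_smul_of_tsupport_subset hs h1.continuous h2 h3 hf'
  have i2 := integrable_smul_of_tsupport_subset hs (h1.continuous_deriv (by simp)) h2.deriv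
    (tsupport_deriv_subset_tsupport.trans h3) hc
  have h5 := integral_eq_zero_of_hasDerivAt_of_integrable hd (i1.add i2)
    (integrable_smul_of_tsupport_subset hs h1.continuous h2 h3 hc)
  rw [integral_add i1 i2] at h5
  exact eq_neg_of_add_eq_zero_right h5

theorem setIntegral_smul_eq (h3 : tsupport ψ ⊆ s) (f : ℝ → ℂ) :
    ∫ x in s, ψ x • f x = ∫ x, ψ x • f x :=
  setIntegral_eq_integral_of_forall_compl_eq_zero fun x hx => by
    rw [image_eq_zero_of_notMem_tsupport fun h => hx (h3 h), zero_smul]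

/-- A test function of mean zero in an interval has a primitive that is a test function. -/
theorem exists_test_primitive {a b : ℝ} {h : ℝ → ℝ} (h1 : ContDiff ℝ ∞ h)
    (h2 : HasCompactSupport h) (h3 : tsupport h ⊆ Ioo a b) (h0 : ∫ x, h x = 0) :
    ∃ ψ : ℝ → ℝ, ContDiff ℝ ∞ ψ ∧ HasCompactSupport ψ ∧ tsupport ψ ⊆ Ioo a b ∧ deriv ψ = h := by
  rcases (tsupport h).eq_empty_or_nonempty with he | hne
  · refine ⟨0, contDiff_const, HasCompactSupport.zero, by simp [tsupport], ?_⟩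
    rw [tsupport_eq_empty_iff] at he
    rw [he]; ext x; simp
  obtain ⟨c, hc, hcmin⟩ := h2.isCompact.exists_isMinOn hne continuousOn_id
  obtain ⟨d, hd, hdmax⟩ := h2.isCompact.exists_isMaxOn hne continuousOn_id
  have hz : ∀ x, x ∉ Icc c d → h x = 0 := fun x hx =>
    image_eq_zero_of_notMem_tsupport fun hx' => hx ⟨hcmin hx', hdmax hx'⟩
  have hcont := h1.continuous
  have hder : ∀ x, HasDerivAt (fun x => ∫ t in c..x, h t) (h x) x := fun x =>
    intervalIntegral.integral_hasDerivAt_right (hcont.intervalIntegrable _ _)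
      (hcont.stronglyMeasurableAtFilter _ _) hcont.continuousAt
  have hderiv : deriv (fun x => ∫ t in c..x, h t) = h := funext fun x => (hder x).deriv
  -- To the left of `c` the integrand is zero; to the right of `d` the integral is the full mean,
  -- zero by hypothesis.
  have hzero : ∀ x, x ∉ Icc c d → ∫ t in c..x, h t = 0 := by
    intro x hx
    rcases lt_or_ge x c with hxc | hxc
    · rw [intervalIntegral.integral_symm, neg_eq_zero]
      rw [intervalIntegral.integral_of_le hxc.le, integral_Ioc_eq_integral_Ioo]
      exact setIntegral_eq_zero_of_forall_eq_zero fun t ht =>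
        hz t fun h => (ht.2.trans_le h.1).false
    · have hxd : d < x := not_le.1 fun h => hx ⟨hxc, h⟩
      rw [intervalIntegral.integral_of_le hxc, ← h0, ← integral_Icc_eq_integral_Ioc]
      refine setIntegral_eq_integral_of_forall_compl_eq_zero fun t ht => hz t fun h => ht ?_
      exact ⟨h.1, h.2.trans hxd.le⟩
  have hts : tsupport (fun x => ∫ t in c..x, h t) ⊆ Icc c d :=
    closure_minimal (fun x hx => by_contra fun h => hx (hzero x h)) isClosed_Icc
  refine ⟨fun x => ∫ t in c..x, h t, ?_, ?_, ?_, hderiv⟩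
  · rw [contDiff_infty_iff_deriv, hderiv]
    exact ⟨fun x => (hder x).differentiableAt, h1⟩
  · exact HasCompactSupport.of_support_subset_isCompact isCompact_Icc
      (subset_closure.trans hts)
  · exact hts.trans (Icc_subset_Ioo (h3 hc).1 (h3 hd).2)

/-- The lemma of du Bois-Reymond. -/
theorem ae_eq_const_of_integral_deriv_smul_eq_zero {a b : ℝ} (hab : a < b)
    (hf : LocallyIntegrableOn f (Ioo a b))
    (h : ∀ ψ : ℝ → ℝ, ContDiff ℝ ∞ ψ → HasCompactSupport ψ → tsupport ψ ⊆ Ioo a b →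
      ∫ x, deriv ψ x • f x = 0) :
    ∃ C : ℂ, ∀ᵐ x ∂volume.restrict (Ioo a b), f x = C := by
  have hint : ∀ g : ℝ → ℝ, Continuous g → HasCompactSupport g → tsupport g ⊆ Ioo a b →
      Integrable fun x => g x • f x := by
    intro g g1 g2 g3
    have e : (fun x => g x • f x) = (tsupport g).indicator fun x => g x • f x := by
      ext x
      by_cases hx : x ∈ tsupport g
      · rw [indicator_of_mem hx]
      · rw [indicator_of_notMem hx, image_eq_zero_of_notMem_tsupport hx, zero_smul]
    rw [e, integrable_indicator_iff (isClosed_tsupport g).measurableSet]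
    exact (hf.integrableOn_compact_subset g3 g2.isCompact).continuousOn_smul g1.continuousOn
      g2.isCompact
  let B : ContDiffBump ((a + b) / 2) :=
    ⟨(b - a) / 8, (b - a) / 4, by linarith, by linarith⟩
  set k : ℝ → ℝ := B.normed volume with hk
  have k1 : ContDiff ℝ ∞ k := B.contDiff_normed
  have k2 : HasCompactSupport k := B.hasCompactSupport_normed
  have k3 : tsupport k ⊆ Ioo a b := by
    rw [hk, B.tsupport_normed_eq, Real.closedBall_eq_Icc]
    exact Icc_subset_Ioo (by change a < _ - (b - a) / 4; linarith)
      (by change _ + (b - a) / 4 < b; linarith)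
  -- The bump `k` has integral one, so the constant must be the average of `f` against it. For a
  -- test function `g` with integral `m`, `g - m k` has mean zero and is therefore the derivative of
  -- a test function.
  set C : ℂ := ∫ x, k x • f x with hC
  refine ⟨C, ?_⟩
  have h0 := isOpen_Ioo.ae_eq_zero_of_integral_contDiff_smul_eq_zero (μ := volume)
    (f := fun x => f x - C) (U := Ioo a b)
    (hf.sub ((locallyIntegrable_const C).locallyIntegrableOn _)) fun g g1 g2 g3 => ?_
  · rw [ae_restrict_iff' measurableSet_Ioo]
    filter_upwards [h0] with x hx hI
    exact sub_eq_zero.1 (hx hI)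
  · have ig : Integrable g := g1.continuous.integrable_of_hasCompactSupport g2
    have ik : Integrable k := k1.continuous.integrable_of_hasCompactSupport k2
    set m := ∫ x, g x with hm
    have hts : tsupport (fun x => g x - m * k x) ⊆ Ioo a b := by
      refine (tsupport_sub g _).trans (union_subset g3 ?_)
      exact (tsupport_mul_subset_right).trans k3
    obtain ⟨ψ, p1, p2, p3, p4⟩ := exists_test_primitive (h := fun x => g x - m * k x)
      (g1.sub (contDiff_const.mul k1)) (g2.sub k2.mul_left) hts (by
        rw [integral_sub ig (ik.const_mul m), integral_const_mul, B.integral_normed]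
        simp [hm])
    have h5 := h ψ p1 p2 p3
    rw [p4] at h5
    simp only [sub_smul, mul_smul] at h5
    have ikf : Integrable fun x => m • k x • f x := (hint k k1.continuous k2 k3).smul m
    rw [integral_sub (hint g g1.continuous g2 g3) ikf, integral_smul] at h5
    simp only [smul_sub]
    rw [integral_sub (hint g g1.continuous g2 g3) (ig.smul_const C), integral_smul_const]
    exact h5

end TestIntegrals

/-! ### The radial equation as a first order system -/

section RadialEquation

variable {r₀ : ℝ}

theorem hasDerivWithinAt_integral_left {g : ℝ → ℂ} (hg : ContinuousOn g (Ioc 0 r₀)) {r : ℝ}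
    (hr : r ∈ Ioc 0 r₀) :
    HasDerivWithinAt (fun x => ∫ t in x..r₀, g t) (-g r) (Ioc 0 r₀) r := by
  have hsub : Icc (r / 2) r₀ ⊆ Ioc 0 r₀ := fun x hx => ⟨(half_pos hr.1).trans_le hx.1, hx.2⟩
  have hmem : r ∈ Icc (r / 2) r₀ := ⟨half_le_self hr.1.le, hr.2⟩
  have hint : IntervalIntegrable g volume r r₀ := by
    refine ContinuousOn.intervalIntegrable (hg.mono ?_)
    rw [uIcc_of_le hr.2]
    exact fun x hx => ⟨hr.1.trans_le hx.1, hx.2⟩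
  have : Fact (r ∈ Icc (r / 2) r₀) := ⟨hmem⟩
  have h1 := intervalIntegral.integral_hasDerivWithinAt_left hint (s := Icc (r / 2) r₀)
    (t := Icc (r / 2) r₀)
    ((hg.mono hsub).stronglyMeasurableAtFilter_nhdsWithin measurableSet_Icc r)
    ((hg.mono hsub) r hmem)
  refine h1.mono_of_mem_nhdsWithin ?_
  filter_upwards [self_mem_nhdsWithin,
    mem_nhdsWithin_of_mem_nhds (lt_mem_nhds (show r / 2 < r by linarith [hr.1]))] with t ht ht'
  exact ⟨ht'.le, ht.2⟩

/-- `(u, p)` solves the first order system `r u' = p`, `p' = -k u` on `(0, r₀]`, with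
`u(r₀) = 0`. -/
structure IsRadialSol (r₀ : ℝ) (k : ℝ → ℝ) (u p : ℝ → ℂ) : Prop where
  deriv_left : ∀ r ∈ Ioc 0 r₀, HasDerivWithinAt u (((r⁻¹ : ℝ) : ℂ) * p r) (Ioc 0 r₀) r
  deriv_right : ∀ r ∈ Ioc 0 r₀, HasDerivWithinAt p (-((k r : ℂ) * u r)) (Ioc 0 r₀) r
  boundary : u r₀ = 0

namespace IsRadialSol

variable {k : ℝ → ℝ} {u p u₁ p₁ : ℝ → ℂ}

theorem hasDerivAt_left (h : IsRadialSol r₀ k u p) {r : ℝ} (hr : r ∈ Ioo 0 r₀) :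
    HasDerivAt u (((r⁻¹ : ℝ) : ℂ) * p r) r :=
  (h.deriv_left r (Ioo_subset_Ioc_self hr)).hasDerivAt (Ioc_mem_nhds hr.1 hr.2)

theorem hasDerivAt_right (h : IsRadialSol r₀ k u p) {r : ℝ} (hr : r ∈ Ioo 0 r₀) :
    HasDerivAt p (-((k r : ℂ) * u r)) r :=
  (h.deriv_right r (Ioo_subset_Ioc_self hr)).hasDerivAt (Ioc_mem_nhds hr.1 hr.2)

theorem smul (h : IsRadialSol r₀ k u p) (c : ℂ) :
    IsRadialSol r₀ k (fun r => c * u r) (fun r => c * p r) where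
  deriv_left r hr := ((h.deriv_left r hr).const_mul c).congr_deriv (by ring)
  deriv_right r hr := ((h.deriv_right r hr).const_mul c).congr_deriv (by ring)
  boundary := by rw [h.boundary, mul_zero]

theorem star (h : IsRadialSol r₀ k u p) :
    IsRadialSol r₀ k (fun r => conj (u r)) (fun r => conj (p r)) where
  deriv_left r hr := (h.deriv_left r hr).star.congr_deriv (by simp)
  deriv_right r hr := (h.deriv_right r hr).star.congr_deriv (by simp)
  boundary := by rw [h.boundary, map_zero]

/-- On each `[δ, r₀]` the system is linear with bounded coefficients, hence Lipschitz, and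
uniqueness runs backwards from the common data at `r₀`. Since `δ > 0` is arbitrary, the singularity
at `0` plays no role. -/
theorem eqOn (h : IsRadialSol r₀ k u p) (h₁ : IsRadialSol r₀ k u₁ p₁)
    (hk : ContinuousOn k (Ioc 0 r₀)) (h0 : p r₀ = p₁ r₀) : EqOn u u₁ (Ioc 0 r₀) := by
  intro δ hδ
  have hsub : Icc δ r₀ ⊆ Ioc 0 r₀ := fun x hx => ⟨hδ.1.trans_le hx.1, hx.2⟩
  obtain ⟨M, hM⟩ := (isCompact_Icc (a := δ) (b := r₀)).exists_bound_of_continuousOn (hk.mono hsub)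
  let v : ℝ → ℂ × ℂ → ℂ × ℂ := fun t y => (((t⁻¹ : ℝ) : ℂ) * y.2, -((k t : ℂ) * y.1))
  have hM0 : 0 ≤ M := (norm_nonneg _).trans (hM δ ⟨le_rfl, hδ.2⟩)
  have hv : ∀ t ∈ Ioc δ r₀, LipschitzOnWith (max δ⁻¹ M).toNNReal (v t) univ := by
    intro t ht
    rw [lipschitzOnWith_univ]
    refine LipschitzWith.of_dist_le_mul fun x y => ?_
    have b1 : ‖((t⁻¹ : ℝ) : ℂ)‖ ≤ max δ⁻¹ M := by
      rw [Complex.norm_real, Real.norm_of_nonneg (inv_nonneg.2 (hδ.1.trans ht.1).le)]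
      exact (inv_anti₀ hδ.1 ht.1.le).trans (le_max_left _ _)
    have b2 : ‖(k t : ℂ)‖ ≤ max δ⁻¹ M := by
      rw [Complex.norm_real]
      exact (hM t (Ioc_subset_Icc_self ht)).trans (le_max_right _ _)
    rw [Real.coe_toNNReal _ (le_max_of_le_right hM0), Prod.dist_eq]
    refine max_le ?_ ?_
    · rw [dist_eq_norm]
      change ‖((t⁻¹ : ℝ) : ℂ) * x.2 - ((t⁻¹ : ℝ) : ℂ) * y.2‖ ≤ _
      rw [← mul_sub, norm_mul, ← dist_eq_norm]
      exact mul_le_mul b1 (le_max_right _ _) dist_nonneg ((norm_nonneg _).trans b1)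
    · rw [dist_eq_norm]
      change ‖-((k t : ℂ) * x.1) - -((k t : ℂ) * y.1)‖ ≤ _
      rw [neg_sub_neg, ← mul_sub, norm_mul, ← dist_eq_norm, dist_comm]
      exact mul_le_mul b2 (le_max_left _ _) dist_nonneg ((norm_nonneg _).trans b2)
  have key : ∀ {u p : ℝ → ℂ}, IsRadialSol r₀ k u p →
      ContinuousOn (fun r => (u r, p r)) (Icc δ r₀) ∧
      ∀ t ∈ Ioc δ r₀, HasDerivWithinAt (fun r => (u r, p r)) (v t (u t, p t)) (Iic t) t := by
    intro u p h
    refine ⟨fun t ht => ?_, fun t ht => ?_⟩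
    · exact (((h.deriv_left t (hsub ht)).continuousWithinAt).prodMk
        ((h.deriv_right t (hsub ht)).continuousWithinAt)).mono hsub
    · have ht' := hsub (Ioc_subset_Icc_self ht)
      refine ((h.deriv_left t ht').prodMk (h.deriv_right t ht')).mono_of_mem_nhdsWithin ?_
      filter_upwards [self_mem_nhdsWithin, mem_nhdsWithin_of_mem_nhds (lt_mem_nhds ht'.1)]
        with x hx hx'
      exact ⟨hx', le_trans hx ht'.2⟩
  have h2 := ODE_solution_unique_of_mem_Icc_left (v := v) (s := fun _ => univ) hv
    (key h).1 (key h).2 (fun _ _ => mem_univ _) (key h₁).1 (key h₁).2 (fun _ _ => mem_univ _)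
    (by simp only [h.boundary, h₁.boundary, h0])
  exact congrArg Prod.fst (h2 ⟨le_rfl, hδ.2⟩)

/-- Bootstrapping: each equation of the system gains one derivative from the other. -/
theorem contDiffOn (h : IsRadialSol r₀ k u p) (hk : ContDiffOn ℝ ∞ k (Ioo 0 r₀)) :
    ContDiffOn ℝ ∞ u (Ioo 0 r₀) := by
  have key : ∀ n : ℕ, ContDiffOn ℝ n u (Ioo 0 r₀) ∧ ContDiffOn ℝ n p (Ioo 0 r₀) := by
    intro n
    induction n with
    | zero =>
      simp only [Nat.cast_zero, contDiffOn_zero]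
      exact ⟨fun r hr => (h.hasDerivAt_left hr).continuousAt.continuousWithinAt,
        fun r hr => (h.hasDerivAt_right hr).continuousAt.continuousWithinAt⟩
    | succ n ih =>
      have hn : (n : WithTop ℕ∞) ≤ ∞ := by exact_mod_cast le_top
      have hk' : ContDiffOn ℝ n (fun r => (k r : ℂ)) (Ioo 0 r₀) :=
        Complex.ofRealCLM.contDiff.comp_contDiffOn (hk.of_le hn)
      have hi : ContDiffOn ℝ n (fun r : ℝ => ((r⁻¹ : ℝ) : ℂ)) (Ioo 0 r₀) :=
        Complex.ofRealCLM.contDiff.comp_contDiffOn (contDiffOn_id.inv fun r hr => hr.1.ne')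
      push_cast
      rw [contDiffOn_succ_iff_deriv_of_isOpen isOpen_Ioo,
        contDiffOn_succ_iff_deriv_of_isOpen isOpen_Ioo]
      refine ⟨⟨fun r hr => (h.hasDerivAt_left hr).differentiableAt.differentiableWithinAt,
        fun h => by simp at h, ?_⟩,
        ⟨fun r hr => (h.hasDerivAt_right hr).differentiableAt.differentiableWithinAt,
        fun h => by simp at h, ?_⟩⟩
      · exact (hi.mul ih.2).congr fun r hr => (h.hasDerivAt_left hr).deriv
      · exact (hk'.mul ih.1).neg.congr fun r hr => (h.hasDerivAt_right hr).deriv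
  exact contDiffOn_infty.2 fun n => (key n).1

end IsRadialSol

end RadialEquation

/-! ### Weak solutions are classical solutions -/

section WeakSolutions

variable {r₀ b : ℝ} {hb : b ≤ 0} {q : ℝ → ℝ} {a Λ : ℝ}

/-- The coefficient `r⁻¹ b - r q + Λ a r³` of the radial equation. -/
noncomputable def radialCoeff (b : ℝ) (q : ℝ → ℝ) (a Λ r : ℝ) : ℝ :=
  b * r⁻¹ - r * q r + Λ * (r * (a * r ^ 2))

theorem continuousOn_radialCoeff (hq : Continuous q) :
    ContinuousOn (radialCoeff b q a Λ) (Ioc 0 r₀) := by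
  unfold radialCoeff
  have : ContinuousOn (fun r : ℝ => r⁻¹) (Ioc 0 r₀) :=
    continuousOn_inv₀.mono fun r hr => hr.1.ne'
  fun_prop

/-- Solutions of the weak eigenvalue problem satisfy the radial equation. -/
theorem exists_isRadialSol (hr₀ : 0 < r₀) (hq : Continuous q) {U : H1 r₀ b hb}
    (hU : IsSol (formOp b hb r₀ hq) (formOp b hb r₀ (continuous_weight a)) Λ U) :
    ∃ u p, IsRadialSol r₀ (radialCoeff b q a Λ) u p ∧
      ∀ᵐ r ∂volume.restrict (Ioo 0 r₀), H1.toL2 r₀ b hb U r = u r := by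
  set g := H1.deriv r₀ b hb U with hg
  set u := prim g with hu
  set k := radialCoeff b q a Λ with hk
  have hkc : ContinuousOn k (Ioc 0 r₀) := continuousOn_radialCoeff hq
  have hku : ContinuousOn (fun r => (k r : ℂ) * u r) (Ioc 0 r₀) :=
    (Complex.continuous_ofReal.comp_continuousOn hkc).mul (continuousOn_prim g)
  set P : ℝ → ℂ := fun r => ∫ t in r..r₀, (k t : ℂ) * u t with hP
  have hPd : ∀ r ∈ Ioc 0 r₀, HasDerivWithinAt P (-((k r : ℂ) * u r)) (Ioc 0 r₀) r := fun r hr =>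
    hasDerivWithinAt_integral_left hku hr
  have hPd' : ∀ r ∈ Ioo 0 r₀, HasDerivAt P (-((k r : ℂ) * u r)) r := fun r hr =>
    (hPd r (Ioo_subset_Ioc_self hr)).hasDerivAt (Ioc_mem_nhds hr.1 hr.2)
  have hPc : ContinuousOn P (Ioo 0 r₀) := fun r hr =>
    (hPd' r hr).continuousAt.continuousWithinAt
  have hint : IntegrableOn (fun r => r • g r) (Ioo 0 r₀) :=
    (integrable_weightMeasure_one_iff _).1 ((Lp.memLp g).integrable (by norm_num))
  have huc : ContinuousOn u (Ioo 0 r₀) := (continuousOn_prim g).mono Ioo_subset_Ioc_self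
  -- The eigenvalue equation tested with `ψ` says that `-k u` is the weak derivative of `r g`.
  have hweak : ∀ ψ : ℝ → ℝ, ContDiff ℝ ∞ ψ → HasCompactSupport ψ → tsupport ψ ⊆ Ioo 0 r₀ →
      ∫ r in Ioo 0 r₀, deriv ψ r • (r • g r) = ∫ r in Ioo 0 r₀, ψ r • ((k r : ℂ) * u r) := by
    intro ψ h1 h2 h3
    have hcont : ∀ f : ℝ → ℝ, ContinuousOn f (Ioo 0 r₀) →
        IntegrableOn (fun r => ψ r • ((f r : ℂ) * u r)) (Ioo 0 r₀) := fun f hf =>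
      (integrable_smul_of_tsupport_subset isOpen_Ioo h1.continuous h2 h3
        ((Complex.continuous_ofReal.comp_continuousOn hf).mul huc)).integrableOn
    have hform : ∀ {f : ℝ → ℝ} (hf : Continuous f),
        inner ℂ ((TestSpace.ofReal h1 h2 h3 : TestSpace r₀ b hb) : H1 r₀ b hb)
          (formOp b hb r₀ hf U) = ∫ r in Ioo 0 r₀, ψ r • (((r * f r : ℝ) : ℂ) * u r) := by
      intro f hf
      rw [inner_formOp, inner_mulOp, H1.toL2_coe]
      refine integral_congr_ae ?_
      filter_upwards [H1.toL2_ae U,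
        testToL2_ae (TestSpace.ofReal h1 h2 h3 : TestSpace r₀ b hb)] with r e1 e2
      rw [e1, e2, TestSpace.fn_ofReal, Complex.conj_ofReal, Complex.real_smul]
      ring
    have h4 := congrArg
      (inner ℂ ((TestSpace.ofReal h1 h2 h3 : TestSpace r₀ b hb) : H1 r₀ b hb)) hU
    rw [inner_add_right, inner_smul_right, hform, hform, H1.inner_coe] at h4
    have e1 : ∫ r in Ioo 0 r₀, (r : ℂ) * (H1.deriv r₀ b hb U r *
        conj (deriv (TestSpace.ofReal h1 h2 h3 : TestSpace r₀ b hb).fn r))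
        = ∫ r in Ioo 0 r₀, deriv ψ r • (r • g r) := by
      congr 1; ext r
      rw [TestSpace.deriv_ofReal, Complex.conj_ofReal, Complex.real_smul, Complex.real_smul]
      ring
    have e2 : ∫ r in Ioo 0 r₀, (r : ℂ)⁻¹ * (H1.toL2 r₀ b hb U r *
        conj ((TestSpace.ofReal h1 h2 h3 : TestSpace r₀ b hb).fn r))
        = ∫ r in Ioo 0 r₀, ψ r • (((r⁻¹ : ℝ) : ℂ) * u r) := by
      refine integral_congr_ae ?_
      filter_upwards [H1.toL2_ae U] with r e1
      rw [e1, TestSpace.fn_ofReal, Complex.conj_ofReal, Complex.real_smul]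
      push_cast
      ring
    rw [e1, e2] at h4
    have i1 := hcont (fun r => r⁻¹) (continuousOn_inv₀.mono fun r hr => hr.1.ne')
    have i2 := hcont (fun r => r * q r) (by fun_prop)
    have i3 := hcont (fun r => r * (a * r ^ 2)) (by fun_prop)
    have e3 : ∫ r in Ioo 0 r₀, ψ r • ((k r : ℂ) * u r)
        = b * (∫ r in Ioo 0 r₀, ψ r • (((r⁻¹ : ℝ) : ℂ) * u r))
          - (∫ r in Ioo 0 r₀, ψ r • (((r * q r : ℝ) : ℂ) * u r))
          + Λ * ∫ r in Ioo 0 r₀, ψ r • (((r * (a * r ^ 2) : ℝ) : ℂ) * u r) := by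
      have i4 : IntegrableOn (fun r => b * (ψ r • (((r⁻¹ : ℝ) : ℂ) * u r))
          - ψ r • (((r * q r : ℝ) : ℂ) * u r)) (Ioo 0 r₀) := (i1.const_mul _).sub i2
      rw [← integral_const_mul, ← integral_const_mul, ← integral_sub (i1.const_mul _) i2,
        ← integral_add i4 (i3.const_mul _)]
      congr 1; ext r
      simp only [hk, radialCoeff, Complex.real_smul]
      push_cast
      ring
    rw [e3]
    linear_combination h4
  -- `P` is an honest primitive of `-k u`, so `r g - P` has zero weak derivative and is a constant.
  obtain ⟨C, hC⟩ := ae_eq_const_of_integral_deriv_smul_eq_zero hr₀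
    (f := fun r => r • g r - P r)
    (hint.locallyIntegrableOn.sub (hPc.locallyIntegrableOn measurableSet_Ioo))
    fun ψ h1 h2 h3 => by
      have h4 := integral_deriv_smul_eq isOpen_Ioo h1 h2 h3 hPd'
        ((hku.mono Ioo_subset_Ioc_self).neg)
      have hd3 : tsupport (deriv ψ) ⊆ Ioo 0 r₀ := tsupport_deriv_subset_tsupport.trans h3
      have h5 := hweak ψ h1 h2 h3
      rw [← setIntegral_smul_eq hd3 P, ← setIntegral_smul_eq h3] at h4
      simp only [smul_neg, integral_neg, neg_neg] at h4
      rw [← setIntegral_smul_eq hd3]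
      simp only [smul_sub]
      rw [integral_sub, h5, h4, sub_self]
      · obtain ⟨M, hM⟩ := h2.deriv.exists_bound_of_continuous (h1.continuous_deriv (by simp))
        exact Integrable.bdd_smul (φ := deriv ψ) hint M
          (h1.continuous_deriv (by simp)).aestronglyMeasurable (ae_of_all _ hM)
      · exact (integrable_smul_of_tsupport_subset isOpen_Ioo (h1.continuous_deriv (by simp))
          h2.deriv hd3 hPc).integrableOn
  refine ⟨u, fun r => P r + C, ⟨fun r hr => ?_, fun r hr => (hPd r hr).add_const C,
    prim_right g⟩, H1.toL2_ae U⟩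
  have hpc : ContinuousOn (fun r : ℝ => ((r⁻¹ : ℝ) : ℂ) * (P r + C)) (Ioc 0 r₀) := by
    refine (Complex.continuous_ofReal.comp_continuousOn
      (continuousOn_inv₀.mono fun r hr => hr.1.ne')).mul ?_
    exact ContinuousOn.add (fun r hr => (hPd r hr).continuousWithinAt) continuousOn_const
  -- Replacing `g` under the integral by its continuous representative makes `u` differentiable at
  -- every point, including `r₀` from the left.
  have hueq : ∀ x ∈ Ioc 0 r₀, u x = -∫ t in x..r₀, ((t⁻¹ : ℝ) : ℂ) * (P t + C) := by
    intro x hx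
    rw [hu, prim, intervalIntegral.integral_of_le hx.2, intervalIntegral.integral_of_le hx.2,
      integral_Ioc_eq_integral_Ioo, integral_Ioc_eq_integral_Ioo]
    congr 1
    refine integral_congr_ae ?_
    filter_upwards [ae_restrict_of_ae_restrict_of_subset (Ioo_subset_Ioo_left hx.1.le) hC,
      ae_restrict_mem measurableSet_Ioo] with t ht htI
    have : (t : ℂ) ≠ 0 := by exact_mod_cast (hx.1.trans htI.1).ne'
    rw [← ht, Complex.real_smul]
    push_cast
    field_simp
    ring
  have h6 := (hasDerivWithinAt_integral_left hpc hr).neg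
  rw [neg_neg] at h6
  exact h6.congr_of_mem (fun x hx => hueq x hx) hr

end WeakSolutions

/-! ### Simplicity, real eigenfunctions, and the basis of `L²(I, 1)` -/

section SimpleEigenvalues

variable {r₀ b : ℝ} {hb : b ≤ 0} {q : ℝ → ℝ} {a Λ : ℝ}

theorem IsRadialSol.zero (k : ℝ → ℝ) : IsRadialSol r₀ k (fun _ => 0) (fun _ => 0) where
  deriv_left r _ := (hasDerivWithinAt_const r _ (0 : ℂ)).congr_deriv (by simp)
  deriv_right r _ := (hasDerivWithinAt_const r _ (0 : ℂ)).congr_deriv (by simp)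
  boundary := rfl

theorem H1.eq_of_ae {U V : H1 r₀ b hb} {f g : ℝ → ℂ}
    (hU : ∀ᵐ r ∂volume.restrict (Ioo 0 r₀), H1.toL2 r₀ b hb U r = f r)
    (hV : ∀ᵐ r ∂volume.restrict (Ioo 0 r₀), H1.toL2 r₀ b hb V r = g r)
    (h : EqOn f g (Ioc 0 r₀)) : U = V := by
  refine H1.toL2_injective (Lp.ext (ae_weightMeasure_one_iff.2 ?_))
  filter_upwards [hU, hV, ae_restrict_mem measurableSet_Ioo] with r h1 h2 hI
  rw [h1, h2, h (Ioo_subset_Ioc_self hI)]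

theorem H1.smul_ae {U : H1 r₀ b hb} {f : ℝ → ℂ} (c : ℂ)
    (hU : ∀ᵐ r ∂volume.restrict (Ioo 0 r₀), H1.toL2 r₀ b hb U r = f r) :
    ∀ᵐ r ∂volume.restrict (Ioo 0 r₀), H1.toL2 r₀ b hb (c • U) r = c * f r := by
  rw [map_smul]
  filter_upwards [hU, ae_weightMeasure_one_iff.1 (Lp.coeFn_smul c (H1.toL2 r₀ b hb U))]
    with r h1 h2
  rw [h2, Pi.smul_apply, h1, smul_eq_mul]

/-- Otherwise both data at `r₀` vanish and uniqueness forces the zero solution. -/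
theorem radialSol_right_ne_zero (hq : Continuous q) {U : H1 r₀ b hb} (h0 : U ≠ 0) {u p : ℝ → ℂ}
    (h : IsRadialSol r₀ (radialCoeff b q a Λ) u p)
    (hU : ∀ᵐ r ∂volume.restrict (Ioo 0 r₀), H1.toL2 r₀ b hb U r = u r) : p r₀ ≠ 0 := by
  intro hp
  refine h0 (H1.eq_of_ae hU (g := fun _ => 0) ?_
    (h.eqOn (IsRadialSol.zero _) (continuousOn_radialCoeff hq) hp))
  rw [map_zero]
  exact ae_weightMeasure_one_iff.1 (Lp.coeFn_zero _ _ _)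

/-- All eigenvalues are simple. -/
theorem exists_eq_smul_of_isSol (hr₀ : 0 < r₀) (hq : Continuous q) {U V : H1 r₀ b hb}
    (hU : IsSol (formOp b hb r₀ hq) (formOp b hb r₀ (continuous_weight a)) Λ U)
    (hV : IsSol (formOp b hb r₀ hq) (formOp b hb r₀ (continuous_weight a)) Λ V)
    (h0 : U ≠ 0) : ∃ c : ℂ, V = c • U := by
  obtain ⟨u, p, hu, huU⟩ := exists_isRadialSol hr₀ hq hU
  obtain ⟨v, s, hv, hvV⟩ := exists_isRadialSol hr₀ hq hV
  have hp := radialSol_right_ne_zero hq h0 hu huU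
  refine ⟨s r₀ / p r₀, H1.eq_of_ae hvV (H1.smul_ae _ huU) ?_⟩
  exact hv.eqOn (hu.smul (s r₀ / p r₀)) (continuousOn_radialCoeff hq)
    (by rw [div_mul_cancel₀ _ hp])

/-- Every eigenspace contains a real-valued eigenfunction. -/
theorem exists_real_isSol (hr₀ : 0 < r₀) (hq : Continuous q)
    (hq' : ContDiffOn ℝ ∞ q (Ioo 0 r₀)) {U : H1 r₀ b hb} (h0 : U ≠ 0)
    (hU : IsSol (formOp b hb r₀ hq) (formOp b hb r₀ (continuous_weight a)) Λ U) :
    ∃ (W : H1 r₀ b hb) (w p : ℝ → ℝ), W ≠ 0 ∧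
      IsSol (formOp b hb r₀ hq) (formOp b hb r₀ (continuous_weight a)) Λ W ∧
      ContDiffOn ℝ ∞ w (Ioo 0 r₀) ∧
      (∀ᵐ r ∂volume.restrict (Ioo 0 r₀), H1.toL2 r₀ b hb W r = (w r : ℂ)) ∧
      (∀ r ∈ Ioo 0 r₀, HasDerivAt w (r⁻¹ * p r) r) ∧
      ∀ r ∈ Ioo 0 r₀, HasDerivAt p (-(radialCoeff b q a Λ r * w r)) r := by
  obtain ⟨u, p, hu, huU⟩ := exists_isRadialSol hr₀ hq hU
  have hp := radialSol_right_ne_zero hq h0 hu huU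
  -- The rescaled solution has data `(0, 1)` at `r₀`. The coefficient is real, so its conjugate
  -- solves the same system with the same data and coincides with it.
  have h1 := hu.smul (p r₀)⁻¹
  have hreal : EqOn (fun r => conj ((p r₀)⁻¹ * u r)) (fun r => (p r₀)⁻¹ * u r) (Ioc 0 r₀) :=
    h1.star.eqOn h1 (continuousOn_radialCoeff hq) (by simp [hp])
  have hre : ∀ r ∈ Ioc 0 r₀, ((((p r₀)⁻¹ * u r).re : ℝ) : ℂ) = (p r₀)⁻¹ * u r := fun r hr =>
    Complex.conj_eq_iff_re.1 (hreal hr)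
  have hk : ContDiffOn ℝ ∞ (radialCoeff b q a Λ) (Ioo 0 r₀) := by
    have h2 : ContDiffOn ℝ ∞ (fun r : ℝ => r⁻¹) (Ioo 0 r₀) :=
      contDiffOn_id.inv fun r hr => hr.1.ne'
    unfold radialCoeff
    exact ((contDiffOn_const.mul h2).sub (contDiffOn_id.mul hq')).add
      (by fun_prop)
  refine ⟨(p r₀)⁻¹ • U, fun r => ((p r₀)⁻¹ * u r).re, fun r => ((p r₀)⁻¹ * p r).re,
    smul_ne_zero (inv_ne_zero hp) h0, hU.smul _, ?_, ?_, fun r hr => ?_, fun r hr => ?_⟩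
  · exact Complex.reCLM.contDiff.comp_contDiffOn (h1.contDiffOn hk)
  · filter_upwards [H1.smul_ae (p r₀)⁻¹ huU, ae_restrict_mem measurableSet_Ioo] with r h2 hI
    rw [h2, hre r (Ioo_subset_Ioc_self hI)]
  · refine ((Complex.reCLM.hasFDerivAt.comp_hasDerivAt r (h1.hasDerivAt_left hr))).congr_deriv ?_
    simp only [Complex.reCLM_apply, Complex.re_ofReal_mul]
  · refine ((Complex.reCLM.hasFDerivAt.comp_hasDerivAt r (h1.hasDerivAt_right hr))).congr_deriv ?_
    simp only [Complex.reCLM_apply, Complex.re_ofReal_mul, Complex.neg_re]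

/-- The basis expansion survives the continuous embedding, whose range is dense. -/
theorem dense_span_of_basis (e : UnconditionalSchauderBasis ℕ ℂ (H1 r₀ b hb)) :
    (Submodule.span ℂ (range fun i => H1.toL2 r₀ b hb (e i))).topologicalClosure = ⊤ := by
  set S := (Submodule.span ℂ (range fun i => H1.toL2 r₀ b hb (e i))).topologicalClosure with hS
  have h1 : ∀ U, H1.toL2 r₀ b hb U ∈ S := fun U => by
    have h2 := (e.expansion U).mapL (H1.toL2 r₀ b hb)
    refine (Submodule.isClosed_topologicalClosure _).mem_of_tendsto h2
      (Eventually.of_forall fun s => ?_)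
    refine Submodule.sum_mem _ fun i _ => ?_
    rw [map_smul]
    exact Submodule.smul_mem _ _ (Submodule.le_topologicalClosure _
      (Submodule.subset_span ⟨i, rfl⟩))
  rw [Submodule.eq_top_iff']
  intro x
  have h3 : closure (range (H1.toL2 r₀ b hb)) ⊆ S :=
    closure_minimal (range_subset_iff.2 h1) (Submodule.isClosed_topologicalClosure _)
  exact h3 (H1.denseRange_toL2 x)

/-- The eigenfunctions form a Markushevich basis of `L²(I, 1)`. -/
theorem isMarkushevichBasis_of_basis (ha : 0 < a) {c : ℝ} (hq : Continuous q)
    (hg : GeneralizedEigenproblem (formOp b hb r₀ hq) (formOp b hb r₀ (continuous_weight a)) c)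
    {Λ : ℕ → ℝ} (hΛ : Function.Injective Λ) (e : UnconditionalSchauderBasis ℕ ℂ (H1 r₀ b hb))
    (he0 : ∀ i, e i ≠ 0)
    (he : ∀ i, IsSol (formOp b hb r₀ hq) (formOp b hb r₀ (continuous_weight a)) (Λ i) (e i)) :
    IsMarkushevichBasis fun i => H1.toL2 r₀ b hb (e i) := by
  refine ⟨dense_span_of_basis e, ?_⟩
  set J := H1.toL2 r₀ b hb
  set M := mulOp r₀ (continuous_weight a)
  have hM : ∀ f g, inner ℂ (M f) g = inner ℂ f (M g) :=
    (isSelfAdjoint_mulOp (continuous_weight a)).isSymmetric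
  have hd : ∀ i, inner ℂ (M (J (e i))) (J (e i)) ≠ 0 := fun i h0 => by
    have h1 := hg.pos (e i) (he0 i)
    rw [inner_formOp, ← hM, h0] at h1
    simp at h1
  have horth : ∀ i j, i ≠ j → inner ℂ (M (J (e i))) (J (e j)) = 0 := fun i j hij => by
    rw [hM, ← inner_formOp]
    exact hg.inner_eq_zero (he i) (he j) (hΛ.ne hij)
  -- Eigenfunctions are orthogonal for the form of the weight, not for the scalar product of `L²(I,
  -- 1)`; hence the functionals pair with `M (J (e i))`.
  refine ⟨fun i => (inner ℂ (M (J (e i))) (J (e i)))⁻¹ • innerSL ℂ (M (J (e i))),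
    fun i j => ?_, fun x hx => ?_⟩
  · change (inner ℂ (M (J (e i))) (J (e i)))⁻¹ * inner ℂ (M (J (e i))) (J (e j)) = _
    split_ifs with hij
    · subst hij
      exact inv_mul_cancel₀ (hd i)
    · rw [horth i j hij, mul_zero]
  · have h1 : ∀ i, inner ℂ (J (e i)) (M x) = 0 := fun i => by
      have h2 : (inner ℂ (M (J (e i))) (J (e i)))⁻¹ * inner ℂ (M (J (e i))) x = 0 := hx i
      rw [← hM]
      exact (mul_eq_zero.1 h2).resolve_left (inv_ne_zero (hd i))
    -- `M x` is orthogonal to the dense span of the eigenfunctions, and `M` is injective because the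
    -- weight is positive on the interval.
    have h3 : M x = 0 := by
      have h4 : M x ∈ (Submodule.span ℂ (range fun i => J (e i)))ᗮ := by
        rw [Submodule.mem_orthogonal]
        intro y hy
        refine Submodule.span_induction (p := fun y _ => inner ℂ y (M x) = 0) ?_ (by simp) ?_ ?_ hy
        · rintro _ ⟨i, rfl⟩
          exact h1 i
        · intro y z _ _ hy hz
          rw [inner_add_left, hy, hz, add_zero]
        · intro c y _ hy
          rw [inner_smul_left, hy, mul_zero]
      rw [(Submodule.topologicalClosure_eq_top_iff).1 (dense_span_of_basis e)] at h4
      exact (Submodule.mem_bot ℂ).1 h4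
    rw [Lp.eq_zero_iff_ae_eq_zero]
    refine ae_weightMeasure_one_iff.2 ?_
    have h5 : ∀ᵐ r ∂volume.restrict (Ioo 0 r₀), M x r = 0 := by
      rw [h3]
      exact ae_weightMeasure_one_iff.1 (Lp.coeFn_zero _ _ _)
    filter_upwards [h5, mulOp_ae (continuous_weight a) x, ae_restrict_mem measurableSet_Ioo]
      with r h6 h7 hI
    rw [h6] at h7
    refine (mul_eq_zero.1 h7.symm).resolve_left ?_
    exact_mod_cast (mul_pos ha (pow_pos hI.1 2)).ne'

end SimpleEigenvalues

/-! ### Separation of variables and the pointwise equation -/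

section Laplace

variable {m : ℕ} {S : Type*} [TopologicalSpace S] [ChartedSpace (EuclideanSpace ℝ (Fin m)) S]
  [IsManifold (𝓡 m) ∞ S]

/-- A scalar passes through `fderiv` without any differentiability, so no regularity of `η` is
involved. -/
theorem laplaceBeltrami_const_mul (G : Metric m S) (c : ℂ) (η : S → ℂ) (x : S) :
    laplaceBeltrami G (fun y => c * η y) x = c * laplaceBeltrami G η x := by
  have h1 : fderiv ℝ ((fun y => c * η y) ∘ (extChartAt (𝓡 m) x).symm)
      = c • fderiv ℝ (η ∘ (extChartAt (𝓡 m) x).symm) :=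
    fderiv_const_smul_field c (f := η ∘ (extChartAt (𝓡 m) x).symm)
  have h2 : ∀ A : Fin m, (fun z => √(gram G x z).det • ∑ B : Fin m, ((gram G x z)⁻¹ A B) •
        fderiv ℝ ((fun y => c * η y) ∘ (extChartAt (𝓡 m) x).symm) z
          (EuclideanSpace.single B (1 : ℝ)))
      = c • fun z => √(gram G x z).det • ∑ B : Fin m, ((gram G x z)⁻¹ A B) •
        fderiv ℝ (η ∘ (extChartAt (𝓡 m) x).symm) z (EuclideanSpace.single B (1 : ℝ)) := by
    intro A
    ext z
    simp only [h1, Pi.smul_apply, smul_apply]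
    rw [smul_comm c]
    congr 1
    rw [Finset.smul_sum]
    refine Finset.sum_congr rfl fun B _ => ?_
    exact smul_comm (M := ℝ) (N := ℂ) (α := ℂ) _ _ _
  unfold laplaceBeltrami
  simp only [h2, fderiv_const_smul_field, Pi.smul_apply, smul_apply]
  rw [← Finset.smul_sum, smul_comm, smul_eq_mul]

end Laplace

section Pointwise

variable {r₀ b : ℝ} {q : ℝ → ℝ} {a Λ : ℝ} {w p : ℝ → ℝ}

theorem deriv_mul_deriv_eq {k : ℝ → ℝ} (hw : ∀ r ∈ Ioo 0 r₀, HasDerivAt w (r⁻¹ * p r) r)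
    (hp : ∀ r ∈ Ioo 0 r₀, HasDerivAt p (-(k r * w r)) r) {r : ℝ} (hr : r ∈ Ioo 0 r₀) :
    deriv (fun s => s * deriv w s) r = -(k r * w r) := by
  have h : (fun s => s * deriv w s) =ᶠ[𝓝 r] p := by
    filter_upwards [Ioo_mem_nhds hr.1 hr.2] with s hs
    rw [(hw s hs).deriv, mul_inv_cancel_left₀ hs.1.ne']
  rw [h.deriv_eq, (hp r hr).deriv]

/-- The radial part of the Hamilton operator on a product; `z` stands for the value of `η` at a
fixed point of `S`. -/
theorem deriv_mul_deriv_ofReal_eq {k : ℝ → ℝ} (hw : ∀ r ∈ Ioo 0 r₀, HasDerivAt w (r⁻¹ * p r) r)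
    (hp : ∀ r ∈ Ioo 0 r₀, HasDerivAt p (-(k r * w r)) r) {r : ℝ} (hr : r ∈ Ioo 0 r₀) (z : ℂ) :
    deriv (fun s : ℝ => (s : ℂ) * deriv (fun t => (w t : ℂ) * z) s) r
      = ((-(k r * w r) : ℝ) : ℂ) * z := by
  have h : (fun s : ℝ => (s : ℂ) * deriv (fun t => (w t : ℂ) * z) s)
      =ᶠ[𝓝 r] fun s => (p s : ℂ) * z := by
    filter_upwards [Ioo_mem_nhds hr.1 hr.2] with s hs
    have hs0 : (s : ℂ) ≠ 0 := by exact_mod_cast hs.1.ne'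
    rw [((hw s hs).ofReal_comp.mul_const z).deriv]
    push_cast
    field_simp
  rw [h.deriv_eq, ((hp r hr).ofReal_comp.mul_const z).deriv]

theorem besselOp_add_eq (hw : ∀ r ∈ Ioo 0 r₀, HasDerivAt w (r⁻¹ * p r) r)
    (hp : ∀ r ∈ Ioo 0 r₀, HasDerivAt p (-(radialCoeff b q a Λ r * w r)) r) {r : ℝ}
    (hr : r ∈ Ioo 0 r₀) : besselOp b w r + q r * w r = Λ * (a * r ^ 2) * w r := by
  have hr0 := hr.1.ne'
  rw [besselOp, deriv_mul_deriv_eq hw hp hr, radialCoeff]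
  field_simp
  ring

end Pointwise

/-! ### Regularity of the potential -/

section Potential

theorem exponent_nonneg {n : ℕ} (hn : 2 ≤ n) : 0 ≤ 2 * ((n : ℝ) - 2) / n := by
  have : (2 : ℝ) ≤ n := by exact_mod_cast hn
  exact div_nonneg (by linarith) (by linarith)

/-- The exponent is nonnegative because `n ≥ 2`, so the power is continuous up to `0` and
multiplication by the potential is bounded. Smoothness holds only away from `0`. -/
theorem continuous_potential {n : ℕ} (hn : 2 ≤ n) (Vb κ : ℝ) :
    Continuous fun r : ℝ => -(16 / (n : ℝ) ^ 2 * Vb * r ^ 2)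
      + 16 / (n : ℝ) ^ 2 * κ * r ^ (2 * ((n : ℝ) - 2) / n) := by
  have := Real.continuous_rpow_const (exponent_nonneg hn)
  fun_prop

theorem contDiffOn_potential (n : ℕ) (Vb κ r₀ : ℝ) :
    ContDiffOn ℝ ∞ (fun r : ℝ => -(16 / (n : ℝ) ^ 2 * Vb * r ^ 2)
      + 16 / (n : ℝ) ^ 2 * κ * r ^ (2 * ((n : ℝ) - 2) / n)) (Ioo 0 r₀) := by
  have h : ContDiffOn ℝ ∞ (fun r : ℝ => r ^ (2 * ((n : ℝ) - 2) / n)) (Ioo 0 r₀) :=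
    contDiffOn_id.rpow_const_of_ne fun r hr => hr.1.ne'
  exact ContDiffOn.add (by fun_prop) (contDiffOn_const.mul h)

end Potential

end FriedmanModel

/-! ### Assembly -/

theorem theorem1p5
    (n m : ℕ) (hn : 2 ≤ n) (hm : 1 ≤ m) (αM V κ r₀ : ℝ) (hα : 0 < αM) (hr₀ : 0 < r₀)
    {S : Type*} [TopologicalSpace S] [T2Space S] [CompactSpace S]
    [ChartedSpace (EuclideanSpace ℝ (Fin m)) S] [IsManifold (𝓡 m) ∞ S]
    (G : FriedmanModel.Metric m S)
    (μ : ℝ) (hμ : FriedmanModel.IsEigenvalue G μ)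
    (hb : FriedmanModel.muBar n m αM μ ≤ 0) :
    ∃ (Λ : ℕ → ℝ) (u : ℕ → ℝ → ℝ) (U : ℕ → FriedmanModel.H1 r₀ (FriedmanModel.muBar n m αM μ) hb),
      -- the eigenvalues are strictly increasing and tend to infinity
      StrictMono Λ ∧ Tendsto Λ atTop atTop ∧
      -- the eigenfunctions are real and smooth in the interval and belong to `H₁`
      (∀ i, ContDiffOn ℝ ∞ (u i) (Ioo 0 r₀)) ∧
      (∀ i, ∀ᵐ r ∂(volume.restrict (Ioo 0 r₀)),
        FriedmanModel.H1.toL2 r₀ (FriedmanModel.muBar n m αM μ) hb (U i) r = (u i r : ℂ)) ∧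
      -- they solve the implicit eigenvalue problem in `H₁`, and there are no other eigenvalues
      (∀ Λ' : ℝ,
        (∃ W : FriedmanModel.H1 r₀ (FriedmanModel.muBar n m αM μ) hb, W ≠ 0 ∧
          FriedmanModel.SolvesEigenvalueProblem n (FriedmanModel.VBar n αM V) κ Λ' W) ↔
        ∃ i, Λ i = Λ') ∧
      -- every eigenvalue has multiplicity one
      (∀ i, U i ≠ 0 ∧ ∀ W : FriedmanModel.H1 r₀ (FriedmanModel.muBar n m αM μ) hb,
        FriedmanModel.SolvesEigenvalueProblem n (FriedmanModel.VBar n αM V) κ (Λ i) W ↔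
          ∃ c : ℂ, W = c • U i) ∧
      -- the differential equation holds pointwise
      (∀ i, ∀ r ∈ Ioo 0 r₀,
        FriedmanModel.besselOp (FriedmanModel.muBar n m αM μ) (u i) r
            - 16 / n ^ 2 * FriedmanModel.VBar n αM V * r ^ 2 * u i r
            + 16 / n ^ 2 * κ * r ^ (2 * ((n : ℝ) - 2) / n) * u i r
          = 16 / n ^ 2 * Λ i * r ^ 2 * u i r) ∧
      -- the eigenfunctions form a basis of `H₁` and a basis of `L²(I, 1)`
      (∃ e : UnconditionalSchauderBasis ℕ ℂ
          (FriedmanModel.H1 r₀ (FriedmanModel.muBar n m αM μ) hb), ∀ i, e i = U i) ∧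
      FriedmanModel.IsMarkushevichBasis (fun i =>
        FriedmanModel.H1.toL2 r₀ (FriedmanModel.muBar n m αM μ) hb (U i)) ∧
      -- the wave functions solve the Wheeler-DeWitt equation
      (∀ η : S → ℂ, FriedmanModel.MemEigenspace G μ η →
        ∀ i, ∀ r ∈ Ioo 0 r₀, ∀ y : S,
          FriedmanModel.hamiltonian n αM V κ (Λ i) G (fun s x => (u i s : ℂ) * η x) r y = 0) := by
  
  have hn0 : (n : ℝ) ≠ 0 := by positivity
  have ha : 0 < 16 / (n : ℝ) ^ 2 := by positivity
  have hq := FriedmanModel.continuous_potential hn (FriedmanModel.VBar n αM V) κ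
  have hsol := FriedmanModel.solvesEigenvalueProblem_iff (r₀ := r₀) (hb := hb) n
    (FriedmanModel.VBar n αM V) κ (hq := hq)
  obtain ⟨c, hg⟩ := FriedmanModel.exists_generalizedEigenproblem (hb := hb) hr₀ hq ha
  have hsimple := fun Λ U W hU hW h0 => FriedmanModel.exists_eq_smul_of_isSol (hb := hb)
    (a := 16 / (n : ℝ) ^ 2) (Λ := Λ) (U := U) (V := W) hr₀ hq hU hW h0
  obtain ⟨Λ, hmono, hlim, hrange, hbasis⟩ := hg.exists_eigenvalues_basis hsimple
    (FriedmanModel.H1.not_finiteDimensional hr₀)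
  choose X hX0 hX using fun i => hrange.subset (mem_range_self i)
  -- The eigenvectors are the real representatives, fixed before the basis is formed so that the
  -- basis consists of exactly these.
  choose U u p hU0 hU hsmooth hae hder hder' using fun i =>
    FriedmanModel.exists_real_isSol hr₀ hq (FriedmanModel.contDiffOn_potential n _ _ _)
      (hX0 i) (hX i)
  obtain ⟨e, he⟩ := hbasis U hU0 hU
  refine ⟨Λ, u, U, hmono, hlim, hsmooth, hae, fun Λ' => ?_, fun i => ⟨hU0 i, fun W => ?_⟩,
    fun i r hr => ?_, ⟨e, he⟩, ?_, fun η hη i r hr y => ?_⟩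
  · simp only [hsol]
    exact (Set.ext_iff.1 hrange Λ').symm
  · rw [hsol]
    refine ⟨fun hW => hsimple _ _ _ (hU i) hW (hU0 i), ?_⟩
    rintro ⟨c, rfl⟩
    exact (hU i).smul c
  · have h := FriedmanModel.besselOp_add_eq (hder i) (hder' i) hr
    linear_combination h
  · have h := FriedmanModel.isMarkushevichBasis_of_basis ha hq hg hmono.injective e
      (fun i => by rw [he]; exact hU0 i) (fun i => by rw [he]; exact hU i)
    simpa only [he] using h
  · have hr0 : (r : ℂ) ≠ 0 := by exact_mod_cast hr.1.ne'
    have hL : FriedmanModel.laplaceBeltrami G η y = -(μ * η y) := by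
      rw [← hη.2 y, neg_neg]
    rw [FriedmanModel.hamiltonian,
      FriedmanModel.deriv_mul_deriv_ofReal_eq (hder i) (hder' i) hr,
      FriedmanModel.laplaceBeltrami_const_mul, hL, FriedmanModel.radialCoeff,
      FriedmanModel.muBar]
    -- Inserting `-Δη = μ η` and the radial equation, the angular term and the shift combine to `r⁻²
    -- muBar`, which cancels the `b r⁻¹` part of `radialCoeff`.
    push_cast
    field_simp
    ring
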